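/- Let $H$ be a separable real Hilbert space, let $Q$ be a bounded selfadjoint nonnegative operator on $H$, and let $A$ be the generator of a strongly continuous semigroup $(S(t))_{t\ge 0}$ on $H$. Put $Q_\infty x=\int_0^\infty S(s)QS^*(s)x\,ds$ for $x\in H$, and assume that $$\int_0^\infty \operatorname{tr}\bigl(S(s)QS^*(s)\bigr)\,ds<\infty\quad\text{and}\quad Q_\infty\text{ is injective.}$$ Let $W$ be a standard cylindrical Wiener process on $H$ over a probability space $(\Omega,P)$. Then the Ornstein–Uhlenbeck process $$Z(t,x)=S(t)x+\int_0^tS(t-s)Q^{1/2}\,dW(s),\qquad t\ge 0,\ x\in H,$$ that is, the mild solution of $dZ=AZ\,dt+Q^{1/2}\,dW$, $Z(0)=x$, is well defined; there is exactly one centered Gaussian measure $\mu$ on $H$ with covariance operator $Q_\infty$; and for every $t\ge 0$ the operator $R_t\phi(x)=E\,\phi(Z(t,x))$, defined for bounded Borel functions $\phi:H\to\mathbb R$, extends uniquely to a bounded operator on $L^2(H,\mu)$, still denoted by $R_t$. Moreover, the following conditions are equivalent. (i) The semigroup $(R_t)$ is symmetric in $L^2(H,\mu)$, that is, $\int_H\psi\,R_t\phi\,d\mu=\int_H\phi\,R_t\psi\,d\mu$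 for all $t\ge0$ and $\phi,\psi\in L^2(H,\mu)$. (ii) If $x\in\operatorname{dom}(A^*)$, then $Qx\in\operatorname{dom}(A)$ and $AQx=QA^*x$. (iii) $S(t)Q=QS^*(t)$ for all $t\ge 0$. -/

import Mathlib

open MeasureTheory ProbabilityTheory Filter Topology Set
open scoped ENNReal NNReal RealInnerProductSpace

noncomputable section

namespace OU

/-- A strongly continuous semigroup of bounded operators `(S(t))_{t ≥ 0}` on `H`.  Times are real
numbers and every law is imposed only for `t ≥ 0`; the values at negative times are never used. -/
structure C0Semigroup (H : Type*) [NormedAddCommGroup H] [InnerProductSpace ℝ H] where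
  op : ℝ → H →L[ℝ] H
  op_zero : op 0 = ContinuousLinearMap.id ℝ H
  op_add : ∀ s t, 0 ≤ s → 0 ≤ t → op (s + t) = (op s).comp (op t)
  continuousOn : ∀ x, ContinuousOn (fun t => op t x) (Ici 0)

section Operators

variable {H : Type*} [NormedAddCommGroup H] [InnerProductSpace ℝ H]

/-- The infinitesimal generator `A` of a semigroup: `x ∈ dom A` iff `(S(t)x - x)/t` converges in
norm as `t ↓ 0`, and `A x` is the limit. -/
def C0Semigroup.generator (S : C0Semigroup H) : H →ₗ.[ℝ] H where
  domain :=
    { carrier := {x | ∃ y, Tendsto (fun t : ℝ => t⁻¹ • (S.op t x - x)) (𝓝[>] 0) (𝓝 y)}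
      add_mem' := by
        rintro a b ⟨y, hy⟩ ⟨z, hz⟩
        refine ⟨y + z, (hy.add hz).congr fun t => ?_⟩
        rw [map_add, ← smul_add]
        congr 1
        abel
      zero_mem' := ⟨0, by simp⟩
      smul_mem' := by
        rintro c a ⟨y, hy⟩
        refine ⟨c • y, (hy.const_smul c).congr fun t => ?_⟩
        rw [map_smul, ← smul_sub, smul_comm] }
  toFun :=
    { toFun := fun x => Classical.choose x.2
      map_add' := by
        intro a b
        refine tendsto_nhds_unique (Classical.choose_spec (a + b).2)
          (((Classical.choose_spec a.2).add (Classical.choose_spec b.2)).congr fun t => ?_)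
        rw [Submodule.coe_add, map_add, ← smul_add]
        congr 1
        abel
      map_smul' := by
        intro c a
        refine tendsto_nhds_unique (Classical.choose_spec (c • a).2)
          (((Classical.choose_spec a.2).const_smul c).congr fun t => ?_)
        rw [Submodule.coe_smul, map_smul, ← smul_sub, smul_comm] }

variable [CompleteSpace H]

open Classical in
/-- The nonnegative square root of a bounded nonnegative selfadjoint operator `T`: the (unique)
bounded nonnegative selfadjoint `B` with `B² = T`. -/
def opSqrt (T : H →L[ℝ] H) : H →L[ℝ] H :=
  if h : ∃ B : H →L[ℝ] H, B.IsPositive ∧ B.comp B = T then Classical.choose h else 0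

/-- The trace, in `[0, ∞]`, of a bounded nonnegative selfadjoint operator, computed in an orthonormal
basis of `H` (for such operators it does not depend on the basis). -/
def posTrace (T : H →L[ℝ] H) : ℝ≥0∞ :=
  ∑' i, ENNReal.ofReal
    ⟪T ((exists_hilbertBasis ℝ H).choose_spec.choose i),
      (exists_hilbertBasis ℝ H).choose_spec.choose i⟫

/-- `S(s) Q S(s)*`. -/
def covIntegrand (S : C0Semigroup H) (Q : H →L[ℝ] H) (s : ℝ) : H →L[ℝ] H :=
  (S.op s).comp (Q.comp (ContinuousLinearMap.adjoint (S.op s)))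

/-- `Q_∞ x = ∫_0^∞ S(s) Q S(s)* x ds`, a Bochner integral in `H`. -/
def Qinf (S : C0Semigroup H) (Q : H →L[ℝ] H) (x : H) : H :=
  ∫ s in Ioi (0 : ℝ), covIntegrand S Q s x

/-- The standing hypothesis: `∫_0^∞ tr (S(s) Q S(s)*) ds < ∞` and `Q_∞` is injective. -/
def StandingHypothesis (S : C0Semigroup H) (Q : H →L[ℝ] H) : Prop :=
  (∫⁻ s in Ioi (0 : ℝ), posTrace (covIntegrand S Q s)) < ∞ ∧ Function.Injective (Qinf S Q)

end Operators

/-- A standard cylindrical Wiener process on `H` over `(Ω, P)`, in the form of an isonormal process: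
a linear isometry `f ↦ ∫_0^∞ ⟨f(s), dW(s)⟩` from `L²((0, ∞); H)` to `L²(Ω, P)` with centered Gaussian
values.  The Wiener process in direction `h` at time `t` is the image of `1_{(0,t]} h`, with
`E[W_t(h) W_s(k)] = min(t, s) ⟨h, k⟩`. -/
structure CylindricalWiener (H : Type*) [NormedAddCommGroup H] [InnerProductSpace ℝ H]
    {Ω : Type*} [MeasurableSpace Ω] (P : Measure Ω) where
  wienerIntegral : Lp H 2 (volume.restrict (Ioi (0 : ℝ))) →ₗᵢ[ℝ] Lp ℝ 2 P
  gaussian : ∀ f, P.map (wienerIntegral f) = gaussianReal 0 (‖f‖₊ ^ 2)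

section Stochastic

variable {H : Type*} [NormedAddCommGroup H] [InnerProductSpace ℝ H] [CompleteSpace H]
  [MeasurableSpace H] {Ω : Type*} [MeasurableSpace Ω] {P : Measure Ω}

/-- For `y ∈ H`, the function `s ↦ 1_{(0,t]}(s) (S(t-s) √Q)* y` on `(0, ∞)`. -/
def mildIntegrand (S : C0Semigroup H) (Q : H →L[ℝ] H) (t : ℝ) (y : H) : ℝ → H :=
  (Ioc 0 t).indicator fun s =>
    ContinuousLinearMap.adjoint ((S.op (t - s)).comp (opSqrt Q)) y

/-- `Z t x` is, for every `t ≥ 0` and `x ∈ H`, the `H`-valued random variable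
`Z(t, x) = S(t) x + ∫_0^t S(t-s) √Q dW(s)`, that is, the mild solution of
`dZ = A Z dt + √Q dW`, `Z(0) = x`.  The stochastic integral of the operator-valued function
`Φ(s) = S(t-s) √Q` is the random vector `I` in `H` with
`⟨I, y⟩ = ∫_0^t ⟨Φ(s)* y, dW(s)⟩` almost surely, for every `y ∈ H`. -/
def IsOUProcess (S : C0Semigroup H) (Q : H →L[ℝ] H) (W : CylindricalWiener H P)
    (Z : ℝ → H → Ω → H) : Prop :=
  ∀ t, 0 ≤ t → ∀ x, AEMeasurable (Z t x) P ∧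
    ∀ y, ∃ h : MemLp (mildIntegrand S Q t y) 2 (volume.restrict (Ioi (0 : ℝ))),
      ∀ᵐ ω ∂P, ⟪Z t x ω, y⟫ = ⟪S.op t x, y⟫ + W.wienerIntegral (h.toLp _) ω

/-- The transition semigroup `R_t φ (x) = E φ(Z(t, x))`. -/
def transition (P : Measure Ω) (Z : ℝ → H → Ω → H) (t : ℝ) (φ : H → ℝ) (x : H) : ℝ :=
  ∫ ω, φ (Z t x ω) ∂P

/-- `μ` is the centered Gaussian measure on `H` with covariance operator `C`. -/
def IsCenteredGaussian [BorelSpace H] (μ : Measure H) (C : H → H) : Prop :=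
  IsGaussian μ ∧ ∫ x, x ∂μ = 0 ∧ ∀ y z, covarianceBilin μ y z = ⟪C y, z⟫

/-- `T` is a bounded operator on `L²(H, μ)` which extends an operator `R` given on bounded Borel
functions. -/
def IsL2Extension (μ : Measure H) (R : (H → ℝ) → H → ℝ) (T : Lp ℝ 2 μ →L[ℝ] Lp ℝ 2 μ) : Prop :=
  ∀ φ : H → ℝ, Measurable φ → (∃ C : ℝ, ∀ x, |φ x| ≤ C) →
    ∀ hφ : MemLp φ 2 μ, T (hφ.toLp φ) =ᵐ[μ] R φ

end Stochastic

end OU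

end

/-!
# Symmetric Ornstein–Uhlenbeck semigroups

Write `√Q` for the square root of `Q`, which exists on a real Hilbert space as the limit of a norm
convergent iteration (`exists_sqrt`), and `Q_t x` for `∫₀ᵗ S(s)QS*(s)x ds`.  The trace
condition says that `F y = (s ↦ √Q S*(s) y)` is a Hilbert–Schmidt operator from
`H` to `L²((0, ∞); H)`, and `Q_∞ = F* F` (`exists_covariance_factor`, `inner_Qinf`).
The composition of an isonormal process with a Hilbert–Schmidt operator is represented by a random
vector (`exists_randomVector`); this yields the process `Z`, and the measure `μ` as the law of the
vector that belongs to `F`.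

Splitting `∫₀^∞` at `t` gives `Q_∞ = Q_t + S(t) Q_∞ S*(t)` (`norm_sq_mild_add`).  As `Z(t, x)` has
the law of `S(t)x + Z(t, 0)`, with `Z(t, 0)` centered Gaussian of covariance `Q_t`, the map
`(x, z) ↦ S(t)x + z` carries `μ ⊗ law(Z(t, 0))` to `μ`.  Hence `R_t = U* V` for two
isometries given by composition (`mehlerOp`), and `⟪R_t φ, ψ⟫ = E[φ(S(t)X + Y) ψ(X)]`
with `X ∼ μ` and `Y ∼ Z(t, 0)` independent.  So `R_t` is symmetric iff the joint law of
`(X, S(t)X + Y)` is invariant under exchange of the two coordinates, and by the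
Gaussian characteristic functions this means `S(t)Q_∞ = Q_∞S*(t)`
(`isSymmetric_mehlerOp_iff`, `jointLaw_swap_eq_iff`).

That condition for all `t` is equivalent to `S(t)Q = QS*(t)` for all `t` (`intertwines_iff_Qinf`):
one direction is integration; conversely `Q_t = Q_∞ - S(2t)Q_∞` satisfies the same commutation
relation, and `Q_t x / t → Qx` as `t ↓ 0`.  Finally `S*` is strongly continuous with generator
`A*` (`C0Semigroup.adjoint`, `C0Semigroup.hasGenerator_adjoint_iff`), and a bounded operator
intertwines two semigroups iff it intertwines their generators
(`C0Semigroup.intertwines_iff_hasGenerator`).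
-/

/-! ### Square roots of nonnegative operators on a real Hilbert space -/

namespace OU

/-- The iteration `Y₀ = 0`, `Yₙ₊₁ = (T + Yₙ²) / 2`, whose limit `Y` satisfies `(1 - Y)² = 1 - T`. -/
noncomputable def sqrtIter {R : Type*} [Ring R] [Algebra ℝ R] (T : R) : ℕ → R
  | 0 => 0
  | n + 1 => (1 / 2 : ℝ) • (T + sqrtIter T n * sqrtIter T n)

lemma sqrtIter_one_bounds (n : ℕ) :
    0 ≤ sqrtIter (1 : ℝ) n ∧ sqrtIter (1 : ℝ) n ≤ 1 := by
  induction n with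
  | zero => simp [sqrtIter]
  | succ n ih => simp only [sqrtIter, smul_eq_mul]; constructor <;> nlinarith [ih.1, ih.2]

section Iteration

variable {R : Type*} [NormedRing R] [NormedAlgebra ℝ R]

lemma norm_sqrtIter_le {T : R} (hT : ‖T‖ ≤ 1) (n : ℕ) :
    ‖sqrtIter T n‖ ≤ sqrtIter (1 : ℝ) n := by
  induction n with
  | zero => simp [sqrtIter]
  | succ n ih =>
    simp only [sqrtIter, smul_eq_mul, norm_smul]
    have h1 : ‖T + sqrtIter T n * sqrtIter T n‖
        ≤ 1 + sqrtIter (1 : ℝ) n * sqrtIter (1 : ℝ) n :=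
      (norm_add_le _ _).trans (add_le_add hT ((norm_mul_le _ _).trans
        (mul_le_mul ih ih (norm_nonneg _) (sqrtIter_one_bounds n).1)))
    norm_num
    linarith

/-- The scalar iteration started with `T = 1` majorizes the increments of the iteration for any `T`
in the unit ball; no commutation is needed. -/
lemma norm_sqrtIter_succ_sub_le {T : R} (hT : ‖T‖ ≤ 1) (n : ℕ) :
    ‖sqrtIter T (n + 1) - sqrtIter T n‖ ≤ sqrtIter (1 : ℝ) (n + 1) - sqrtIter (1 : ℝ) n := by
  induction n with
  | zero => simpa [sqrtIter, norm_smul] using hT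
  | succ n ih =>
    have key : ∀ {A : Type _} [Ring A] [Algebra ℝ A] (X : A),
        sqrtIter X (n + 2) - sqrtIter X (n + 1) = (1 / 2 : ℝ) •
          (sqrtIter X (n + 1) * (sqrtIter X (n + 1) - sqrtIter X n)
            + (sqrtIter X (n + 1) - sqrtIter X n) * sqrtIter X n) := by
      intro A _ _ X
      conv_lhs => rw [sqrtIter, sqrtIter.eq_2 X n, ← smul_sub]
      rw [← sqrtIter.eq_2 X n]
      congr 1
      noncomm_ring
    have key1 : sqrtIter (1 : ℝ) (n + 2) - sqrtIter (1 : ℝ) (n + 1) = (1 / 2 : ℝ) *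
          (sqrtIter (1 : ℝ) (n + 1) * (sqrtIter (1 : ℝ) (n + 1) - sqrtIter (1 : ℝ) n)
            + (sqrtIter (1 : ℝ) (n + 1) - sqrtIter (1 : ℝ) n) * sqrtIter (1 : ℝ) n) := by
      conv_lhs => rw [sqrtIter, sqrtIter.eq_2 (1 : ℝ) n]
      simp only [smul_eq_mul]
      rw [sqrtIter.eq_2 (1 : ℝ) n]
      simp only [smul_eq_mul]
      ring
    rw [key, key1, norm_smul]
    have h0 : ‖(1 / 2 : ℝ)‖ = 1 / 2 := by norm_num
    rw [h0]
    gcongr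
    refine (norm_add_le _ _).trans (add_le_add ?_ ?_)
    · refine (norm_mul_le _ _).trans ?_
      have := norm_sqrtIter_le hT (n + 1)
      gcongr
      exact (norm_nonneg _).trans this
    · refine (norm_mul_le _ _).trans ?_
      have := norm_sqrtIter_le hT n
      gcongr
      exact (norm_nonneg _).trans ih

lemma cauchySeq_sqrtIter {T : R} (hT : ‖T‖ ≤ 1) : CauchySeq (sqrtIter T) := by
  refine cauchySeq_of_dist_le_of_summable
    (fun n => sqrtIter (1 : ℝ) (n + 1) - sqrtIter (1 : ℝ) n) (fun n => ?_) ?_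
  · rw [dist_comm, dist_eq_norm]
    exact norm_sqrtIter_succ_sub_le hT n
  · refine summable_of_sum_range_le (c := 1)
      (fun n => (norm_nonneg _).trans (norm_sqrtIter_succ_sub_le hT n)) fun n => ?_
    rw [Finset.sum_range_sub]
    have := (sqrtIter_one_bounds n).2
    simpa [sqrtIter] using this

end Iteration

variable {H : Type*} [NormedAddCommGroup H] [InnerProductSpace ℝ H]

lemma norm_one_sub_le_of_isPositive {P : H →L[ℝ] H} (hP : P.IsPositive) (h1 : ‖P‖ ≤ 1) :
    ‖1 - P‖ ≤ 1 := by
  have hsym : (1 - P).IsSymmetric := by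
    intro x y
    have := hP.isSymmetric x y
    simp only [ContinuousLinearMap.coe_coe] at this
    simp [inner_sub_left, inner_sub_right, this]
  rw [ContinuousLinearMap.norm_eq_iSup_rayleighQuotient _ hsym]
  refine ciSup_le fun x => ?_
  rw [ContinuousLinearMap.rayleighQuotient, ContinuousLinearMap.reApplyInnerSelf_apply, abs_div,
    abs_of_nonneg (sq_nonneg ‖x‖)]
  refine div_le_one_of_le₀ ?_ (sq_nonneg _)
  have h2 : 0 ≤ ⟪P x, x⟫ := hP.inner_nonneg_left x
  have h3 : ⟪P x, x⟫ ≤ ‖x‖ ^ 2 := by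
    calc ⟪P x, x⟫ ≤ ‖P x‖ * ‖x‖ := real_inner_le_norm _ _
      _ ≤ (1 * ‖x‖) * ‖x‖ := by gcongr; exact P.le_of_opNorm_le h1 x
      _ = ‖x‖ ^ 2 := by ring
  have h4 : RCLike.re ⟪(1 - P) x, x⟫ = ‖x‖ ^ 2 - ⟪P x, x⟫ := by
    simp [inner_sub_left]
  rw [h4, abs_le]
  constructor <;> nlinarith

variable [CompleteSpace H]

lemma exists_sqrt_of_norm_le_one {P : H →L[ℝ] H} (hP : P.IsPositive) (h1 : ‖P‖ ≤ 1) :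
    ∃ B : H →L[ℝ] H, B.IsPositive ∧ B.comp B = P := by
  have hT := norm_one_sub_le_of_isPositive hP h1
  obtain ⟨Y, hY⟩ := cauchySeq_tendsto_of_complete (cauchySeq_sqrtIter hT)
  have hfix : Y = (1 / 2 : ℝ) • ((1 - P) + Y * Y) :=
    tendsto_nhds_unique ((tendsto_add_atTop_iff_nat 1).2 hY)
      (((hY.mul hY).const_add (1 - P)).const_smul (1 / 2 : ℝ))
  have hn : ‖Y‖ ≤ 1 := le_of_tendsto' hY.norm fun n =>
    (norm_sqrtIter_le hT n).trans (sqrtIter_one_bounds n).2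
  have hsa : IsSelfAdjoint Y := by
    have hsa' : ∀ n, IsSelfAdjoint (sqrtIter (1 - P) n) := by
      intro n
      induction n with
      | zero => exact .zero _
      | succ n ih =>
        refine IsSelfAdjoint.smul (.all _) (((IsSelfAdjoint.one _).sub hP.isSelfAdjoint).add ?_)
        rw [IsSelfAdjoint, star_mul, ih.star_eq]
    refine tendsto_nhds_unique (hY.star.congr fun n => (hsa' n).star_eq) hY
  refine ⟨1 - Y, ?_, ?_⟩
  · rw [ContinuousLinearMap.isPositive_def']
    refine ⟨(IsSelfAdjoint.one _).sub hsa, fun x => ?_⟩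
    rw [ContinuousLinearMap.reApplyInnerSelf_apply]
    have h4 : RCLike.re ⟪(1 - Y) x, x⟫ = ‖x‖ ^ 2 - ⟪Y x, x⟫ := by
      simp [inner_sub_left]
    have h3 : ⟪Y x, x⟫ ≤ ‖x‖ ^ 2 := by
      calc ⟪Y x, x⟫ ≤ ‖Y x‖ * ‖x‖ := real_inner_le_norm _ _
        _ ≤ (1 * ‖x‖) * ‖x‖ := by gcongr; exact Y.le_of_opNorm_le hn x
        _ = ‖x‖ ^ 2 := by ring
    rw [h4]; linarith
  · change (1 - Y) * (1 - Y) = P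
    have h2 : (2 : ℝ) • Y = (1 - P) + Y * Y := by
      conv_lhs => rw [hfix]
      rw [smul_smul]; norm_num
    have h5 : (1 - Y) * (1 - Y) = 1 - (2 : ℝ) • Y + Y * Y := by
      rw [two_smul]; noncomm_ring
    rw [h5, h2]; abel

/-- Every bounded nonnegative selfadjoint operator on a real Hilbert space has a nonnegative square
root, so that `opSqrt` never takes its default value on such operators. -/
lemma exists_sqrt {T : H →L[ℝ] H} (hT : T.IsPositive) :
    ∃ B : H →L[ℝ] H, B.IsPositive ∧ B.comp B = T := by
  set c : ℝ := ‖T‖ + 1 with hc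
  have hc0 : 0 < c := by positivity
  obtain ⟨B, hB, hBB⟩ := exists_sqrt_of_norm_le_one
    (P := c⁻¹ • T) (hT.smul_of_nonneg (inv_nonneg.2 hc0.le)) (by
      rw [norm_smul, Real.norm_of_nonneg (inv_nonneg.2 hc0.le), inv_mul_le_iff₀ hc0]
      linarith)
  refine ⟨√c • B, hB.smul_of_nonneg (Real.sqrt_nonneg c), ?_⟩
  rw [ContinuousLinearMap.smul_comp, ContinuousLinearMap.comp_smul, hBB, smul_smul, smul_smul,
    Real.mul_self_sqrt hc0.le, mul_inv_cancel₀ hc0.ne', one_smul]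

lemma opSqrt_isPositive {T : H →L[ℝ] H} (hT : T.IsPositive) : (opSqrt T).IsPositive := by
  rw [opSqrt, dif_pos (exists_sqrt hT)]
  exact (Classical.choose_spec (exists_sqrt hT)).1

lemma opSqrt_comp_opSqrt {T : H →L[ℝ] H} (hT : T.IsPositive) :
    (opSqrt T).comp (opSqrt T) = T := by
  rw [opSqrt, dif_pos (exists_sqrt hT)]
  exact (Classical.choose_spec (exists_sqrt hT)).2

end OU

/-! ### Strongly continuous semigroups and their adjoints -/

namespace OU

section Averages

variable {E : Type*} [NormedAddCommGroup E]

lemma intervalIntegrable_of_continuousOn_Ici {f : ℝ → E} {c a b : ℝ}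
    (hf : ContinuousOn f (Ici c)) (ha : c ≤ a) (hb : c ≤ b) :
    IntervalIntegrable f volume a b :=
  (hf.mono fun _ hx => (le_min ha hb).trans hx.1).intervalIntegrable

variable [NormedSpace ℝ E]

/-- Right averages of a continuous function converge to its value. -/
lemma tendsto_average_right [CompleteSpace E] {f : ℝ → E} {a : ℝ}
    (hf : ContinuousOn f (Ici a)) :
    Tendsto (fun t : ℝ => t⁻¹ • ∫ s in a..a + t, f s) (𝓝[>] 0) (𝓝 (f a)) := by
  have hg : Continuous fun s => f (max s a) :=
    hf.comp_continuous (by fun_prop) fun s => le_max_right s a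
  have h := (hg.integral_hasStrictDerivAt a a).hasDerivAt.tendsto_slope_zero_right
  simp only [intervalIntegral.integral_same, sub_zero, max_self] at h
  refine h.congr' ?_
  filter_upwards [self_mem_nhdsWithin] with t ht
  congr 1
  refine intervalIntegral.integral_congr fun s hs => ?_
  rw [uIcc_of_le (by linarith [mem_Ioi.1 ht])] at hs
  simp only [max_eq_left hs.1]

end Averages

namespace C0Semigroup

variable {H : Type*} [NormedAddCommGroup H] [InnerProductSpace ℝ H]

lemma op_add_apply (S : C0Semigroup H) {s t : ℝ} (hs : 0 ≤ s) (ht : 0 ≤ t) (x : H) :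
    S.op (s + t) x = S.op s (S.op t x) := by
  rw [S.op_add s t hs ht]; rfl

lemma op_comm_apply (S : C0Semigroup H) {s t : ℝ} (hs : 0 ≤ s) (ht : 0 ≤ t) (x : H) :
    S.op s (S.op t x) = S.op t (S.op s x) := by
  rw [← S.op_add_apply hs ht, ← S.op_add_apply ht hs, add_comm]

lemma op_zero_apply (S : C0Semigroup H) (x : H) : S.op 0 x = x := by
  rw [S.op_zero]; rfl

/-- `x` lies in the domain of the generator of `S`, with value `y`. -/
def HasGenerator (S : C0Semigroup H) (x y : H) : Prop :=
  Tendsto (fun t : ℝ => t⁻¹ • (S.op t x - x)) (𝓝[>] 0) (𝓝 y)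

lemma hasGenerator_generator (S : C0Semigroup H) (x : S.generator.domain) :
    S.HasGenerator x (S.generator x) :=
  Classical.choose_spec x.2

lemma hasGenerator_iff (S : C0Semigroup H) {x y : H} :
    S.HasGenerator x y ↔ ∃ h : x ∈ S.generator.domain, S.generator ⟨x, h⟩ = y := by
  constructor
  · intro h
    have hx : x ∈ S.generator.domain := ⟨y, h⟩
    exact ⟨hx, tendsto_nhds_unique (S.hasGenerator_generator ⟨x, hx⟩) h⟩
  · rintro ⟨h, rfl⟩
    exact S.hasGenerator_generator ⟨x, h⟩

lemma HasGenerator.op {S : C0Semigroup H} {x y : H} (h : S.HasGenerator x y) {s : ℝ}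
    (hs : 0 ≤ s) : S.HasGenerator (S.op s x) (S.op s y) := by
  refine (((S.op s).continuous.tendsto y).comp h).congr' ?_
  filter_upwards [self_mem_nhdsWithin] with t ht
  simp only [Function.comp, map_smul, map_sub, S.op_comm_apply hs (mem_Ioi.1 ht).le]

variable [CompleteSpace H]

lemma exists_norm_op_le (S : C0Semigroup H) (T : ℝ) :
    ∃ M : ℝ, 0 ≤ M ∧ ∀ t ∈ Icc 0 T, ‖S.op t‖ ≤ M := by
  obtain ⟨M, hM⟩ := banach_steinhaus (g := fun t : Icc (0 : ℝ) T => S.op t) fun x => by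
    obtain ⟨C, hC⟩ := isCompact_Icc.exists_bound_of_continuousOn
      ((S.continuousOn x).mono (fun _ h => h.1 : Icc 0 T ⊆ Ici 0))
    exact ⟨C, fun t => hC t t.2⟩
  exact ⟨max M 0, le_max_right _ _, fun t ht => (hM ⟨t, ht⟩).trans (le_max_left _ _)⟩

/-- Joint continuity of `(t, x) ↦ S(t)x`. -/
lemma tendsto_op_apply (S : C0Semigroup H) {α : Type*} {l : Filter α} {τ : α → ℝ} {u : α → H}
    {t : ℝ} {x : H} (ht : 0 ≤ t) (hτ0 : ∀ᶠ a in l, 0 ≤ τ a) (hτ : Tendsto τ l (𝓝 t))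
    (hu : Tendsto u l (𝓝 x)) :
    Tendsto (fun a => S.op (τ a) (u a)) l (𝓝 (S.op t x)) := by
  obtain ⟨M, hM0, hM⟩ := S.exists_norm_op_le (t + 1)
  have h1 : Tendsto (fun a => S.op (τ a) x) l (𝓝 (S.op t x)) :=
    (S.continuousOn x t ht).tendsto.comp (tendsto_nhdsWithin_iff.2 ⟨hτ, hτ0⟩)
  have h2 : Tendsto (fun a => S.op (τ a) (u a - x)) l (𝓝 0) := by
    have h3 : Tendsto (fun a => M * ‖u a - x‖) l (𝓝 0) := by
      simpa using ((hu.sub_const x).norm).const_mul M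
    refine squeeze_zero_norm' ?_ h3
    filter_upwards [hτ0, hτ.eventually (Iic_mem_nhds (by linarith : t < t + 1))] with a ha hb
    exact (S.op (τ a)).le_of_opNorm_le (hM _ ⟨ha, hb⟩) _
  simpa using h2.add h1

lemma continuousOn_op_apply (S : C0Semigroup H) {u : ℝ → H} {τ : ℝ → ℝ} {s : Set ℝ}
    (hτ : ContinuousOn τ s) (hτ0 : ∀ r ∈ s, 0 ≤ τ r) (hu : ContinuousOn u s) :
    ContinuousOn (fun r => S.op (τ r) (u r)) s := fun r hr =>
  S.tendsto_op_apply (hτ0 r hr) (eventually_nhdsWithin_of_forall hτ0) (hτ r hr) (hu r hr)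

/-- `∫₀ʰ S(s)y ds` lies in the domain of the generator, with value `S(h)y - y`. -/
lemma hasGenerator_integral (S : C0Semigroup H) {h : ℝ} (hh : 0 ≤ h) (y : H) :
    S.HasGenerator (∫ s in (0 : ℝ)..h, S.op s y) (S.op h y - y) := by
  have hc := S.continuousOn y
  have h1 := tendsto_average_right (hc.mono (Ici_subset_Ici.2 hh))
  have h2 := tendsto_average_right hc
  rw [S.op_zero_apply] at h2
  refine (h1.sub h2).congr' ?_
  filter_upwards [self_mem_nhdsWithin] with t ht
  have ht0 : 0 ≤ t := (mem_Ioi.1 ht).le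
  have hi : ∀ {a b : ℝ}, 0 ≤ a → 0 ≤ b →
      IntervalIntegrable (fun s => S.op s y) volume a b :=
    fun ha hb => intervalIntegrable_of_continuousOn_Ici hc ha hb
  have h3 : S.op t (∫ s in (0 : ℝ)..h, S.op s y) = ∫ s in t..h + t, S.op s y := by
    rw [← ContinuousLinearMap.intervalIntegral_comp_comm _ (hi le_rfl hh)]
    have : ∫ s in (0 : ℝ)..h, S.op t (S.op s y) = ∫ s in (0 : ℝ)..h, S.op (s + t) y := by
      refine intervalIntegral.integral_congr fun s hs => ?_
      rw [uIcc_of_le hh] at hs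
      simp only [S.op_comm_apply ht0 hs.1, S.op_add_apply hs.1 ht0]
    rw [this, intervalIntegral.integral_comp_add_right (fun s => S.op s y), zero_add]
  have hht : 0 ≤ h + t := add_nonneg hh ht0
  rw [h3, ← smul_sub, zero_add,
    ← intervalIntegral.integral_add_adjacent_intervals (hi ht0 hh) (hi hh hht),
    ← intervalIntegral.integral_add_adjacent_intervals (hi le_rfl ht0) (hi ht0 hh)]
  congr 1
  abel

lemma dense_generator_domain (S : C0Semigroup H) : Dense (S.generator.domain : Set H) := by
  intro y
  have h := tendsto_average_right (S.continuousOn y)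
  rw [S.op_zero_apply] at h
  refine mem_closure_of_tendsto h ?_
  filter_upwards [self_mem_nhdsWithin] with t ht
  rw [zero_add]
  exact Submodule.smul_mem _ _ (S.hasGenerator_iff.1
    (S.hasGenerator_integral (mem_Ioi.1 ht).le y)).1

/-- For `x` in the domain of `A*`, `S*(t)x - x` is the weak integral of `S*(s)A*x` over `[0, t]`. -/
lemma inner_adjoint_op_sub (S : C0Semigroup H) (x : S.generator.adjoint.domain) {t : ℝ}
    (ht : 0 ≤ t) (y : H) :
    ⟪ContinuousLinearMap.adjoint (S.op t) (x : H) - x, y⟫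
      = ⟪S.generator.adjoint x, ∫ s in (0 : ℝ)..t, S.op s y⟫ := by
  obtain ⟨h1, h2⟩ := S.hasGenerator_iff.1 (S.hasGenerator_integral ht y)
  rw [LinearPMap.adjoint_isFormalAdjoint S.dense_generator_domain x ⟨_, h1⟩, h2, inner_sub_left,
    inner_sub_right, ContinuousLinearMap.adjoint_inner_left]

lemma dense_adjoint_domain (S : C0Semigroup H) :
    Dense (S.generator.adjoint.domain : Set H) := by
  rw [Submodule.dense_iff_topologicalClosure_eq_top,
    Submodule.topologicalClosure_eq_top_iff, Submodule.eq_bot_iff]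
  intro z hz
  -- The adjoint of `B y = ∫₀ᵗ S(s)y ds` maps `H` into `dom A*`, so that `B z = 0` if `z ⟂ dom A*`.
  have key : ∀ t : ℝ, 0 < t → ∫ s in (0 : ℝ)..t, S.op s z = 0 := by
    intro t ht
    refine ext_inner_left ℝ fun x => ?_
    obtain ⟨M, -, hM⟩ := S.exists_norm_op_le t
    have hi : ∀ y, IntervalIntegrable (fun s => S.op s y) volume 0 t := fun y =>
      intervalIntegrable_of_continuousOn_Ici (S.continuousOn y) le_rfl ht.le
    let B : H →L[ℝ] H := LinearMap.mkContinuous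
      { toFun := fun y => ∫ s in (0 : ℝ)..t, S.op s y
        map_add' := fun y y' => by
          simp only [map_add]; exact intervalIntegral.integral_add (hi y) (hi y')
        map_smul' := fun c y => by
          simp only [map_smul, RingHom.id_apply]; exact intervalIntegral.integral_smul c _ }
      (M * t) fun y => by
        have := intervalIntegral.norm_integral_le_of_norm_le_const (a := 0) (b := t)
          (f := fun s => S.op s y) (C := M * ‖y‖) fun s hs => by
            rw [uIoc_of_le ht.le] at hs
            exact (S.op s).le_of_opNorm_le (hM s ⟨hs.1.le, hs.2⟩) y
        rw [sub_zero, abs_of_pos ht] at this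
        calc _ ≤ M * ‖y‖ * t := this
          _ = M * t * ‖y‖ := by ring
    have hB : ∀ y, B y = ∫ s in (0 : ℝ)..t, S.op s y := fun y => rfl
    have hcomm : ∀ y : S.generator.domain, B (S.generator y) = S.op t (y : H) - y := by
      intro y
      have hg := S.hasGenerator_generator y
      have h1 : S.HasGenerator (B y) (S.op t (y : H) - y) := S.hasGenerator_integral ht.le y
      refine tendsto_nhds_unique ((B.continuous.tendsto _).comp hg) (h1.congr' ?_)
      filter_upwards [self_mem_nhdsWithin] with r hr
      simp only [Function.comp, map_smul, map_sub]
      congr 2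
      simp only [hB]
      rw [← ContinuousLinearMap.intervalIntegral_comp_comm _ (hi _)]
      refine intervalIntegral.integral_congr fun s hs => ?_
      rw [uIcc_of_le ht.le] at hs
      exact S.op_comm_apply (mem_Ioi.1 hr).le hs.1 _
    have hmem : ContinuousLinearMap.adjoint B x ∈ S.generator.adjoint.domain := by
      refine LinearPMap.mem_adjoint_domain_of_exists _
        ⟨ContinuousLinearMap.adjoint (S.op t) x - x, fun y => ?_⟩
      rw [ContinuousLinearMap.adjoint_inner_left, hcomm, inner_sub_left, inner_sub_right,
        ContinuousLinearMap.adjoint_inner_left]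
    rw [inner_zero_right, ← hB, ← ContinuousLinearMap.adjoint_inner_left]
    exact (Submodule.mem_orthogonal _ _).1 hz _ hmem
  have h := tendsto_average_right (S.continuousOn z)
  rw [S.op_zero_apply] at h
  refine tendsto_nhds_unique h (tendsto_const_nhds.congr' ?_)
  filter_upwards [self_mem_nhdsWithin] with t ht
  rw [zero_add, key t ht, smul_zero]

lemma tendsto_adjoint_op_zero (S : C0Semigroup H) (z : H) :
    Tendsto (fun t => ContinuousLinearMap.adjoint (S.op t) z) (𝓝[≥] 0) (𝓝 z) := by
  obtain ⟨M, hM0, hM⟩ := S.exists_norm_op_le 1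
  rw [Metric.tendsto_nhds]
  intro ε hε
  obtain ⟨x, hx, hxz⟩ := S.dense_adjoint_domain.exists_dist_lt z
    (show 0 < ε / (2 * (M + 1)) by positivity)
  set a := S.generator.adjoint ⟨x, hx⟩ with ha
  have hlip : ∀ t ∈ Icc (0 : ℝ) 1,
      ‖ContinuousLinearMap.adjoint (S.op t) x - x‖ ≤ ‖a‖ * (M * t) := by
    intro t ht
    refine ContinuousLinearMap.opNorm_le_bound (innerSL ℝ _) (by have := ht.1; positivity)
      (fun y => ?_) |>.trans' (innerSL_apply_norm ℝ _).ge
    rw [innerSL_apply_apply, S.inner_adjoint_op_sub ⟨x, hx⟩ ht.1 y]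
    refine (norm_inner_le_norm _ _).trans ?_
    have := intervalIntegral.norm_integral_le_of_norm_le_const (a := 0) (b := t)
      (f := fun s => S.op s y) (C := M * ‖y‖) fun s hs => by
        rw [uIoc_of_le ht.1] at hs
        exact (S.op s).le_of_opNorm_le (hM s ⟨hs.1.le, hs.2.trans ht.2⟩) y
    rw [sub_zero, abs_of_nonneg ht.1] at this
    calc _ ≤ ‖a‖ * (M * ‖y‖ * t) := by gcongr
      _ = _ := by ring
  have hlim : Tendsto (fun t : ℝ => ‖a‖ * (M * t)) (𝓝[≥] 0) (𝓝 0) := by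
    have : Continuous fun t : ℝ => ‖a‖ * (M * t) := by fun_prop
    simpa using (this.tendsto 0).mono_left nhdsWithin_le_nhds
  filter_upwards [hlim.eventually (Iio_mem_nhds (half_pos hε)), self_mem_nhdsWithin,
    nhdsWithin_le_nhds (Iic_mem_nhds one_pos)] with t h1 h2 h3
  have h4 : ‖ContinuousLinearMap.adjoint (S.op t) (z - x)‖ ≤ M * ‖z - x‖ :=
    ContinuousLinearMap.le_of_opNorm_le _
      ((LinearIsometryEquiv.norm_map _ _).trans_le (hM t ⟨h2, h3⟩)) _
  rw [dist_eq_norm] at hxz ⊢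
  rw [lt_div_iff₀ (by positivity)] at hxz
  calc ‖ContinuousLinearMap.adjoint (S.op t) z - z‖
      = ‖ContinuousLinearMap.adjoint (S.op t) (z - x)
          + (ContinuousLinearMap.adjoint (S.op t) x - x) - (z - x)‖ := by
        rw [map_sub]; congr 1; abel
    _ ≤ ‖ContinuousLinearMap.adjoint (S.op t) (z - x)‖
          + ‖ContinuousLinearMap.adjoint (S.op t) x - x‖ + ‖z - x‖ :=
        (norm_sub_le _ _).trans (by gcongr; exact norm_add_le _ _)
    _ ≤ M * ‖z - x‖ + ‖a‖ * (M * t) + ‖z - x‖ := by gcongr; exact hlip t ⟨h2, h3⟩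
    _ < ε := by linarith [show ‖a‖ * (M * t) < ε / 2 from h1]

/-- The adjoint semigroup `S*(t) = S(t)*`.  It is strongly continuous because `dom A*` is dense and
`t ↦ S*(t)x` is Lipschitz near `0` for `x ∈ dom A*`. -/
noncomputable def adjoint (S : C0Semigroup H) : C0Semigroup H where
  op t := ContinuousLinearMap.adjoint (S.op t)
  op_zero := by rw [S.op_zero, ContinuousLinearMap.adjoint_id]
  op_add s t hs ht := by rw [add_comm, S.op_add t s ht hs, ContinuousLinearMap.adjoint_comp]
  continuousOn z := by
    intro t ht
    obtain ⟨M, hM0, hM⟩ := S.exists_norm_op_le (t + 1)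
    have hdist : Tendsto (fun r => |r - t|) (𝓝[≥] t ⊔ 𝓝[≤] t) (𝓝[≥] 0) := by
      refine tendsto_nhdsWithin_iff.2
        ⟨?_, Eventually.of_forall fun r => mem_Ici.2 (abs_nonneg (r - t))⟩
      have : Continuous fun r : ℝ => |r - t| := by fun_prop
      simpa using (this.tendsto t).mono_left (sup_le nhdsWithin_le_nhds nhdsWithin_le_nhds)
    rw [nhdsGE_sup_nhdsLE] at hdist
    have hz : Tendsto (fun r => M *
        ‖ContinuousLinearMap.adjoint (S.op |r - t|) z - z‖) (𝓝[Ici 0] t) (𝓝 0) := by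
      simpa using ((((S.tendsto_adjoint_op_zero z).comp hdist).sub_const z).norm.const_mul
        M).mono_left nhdsWithin_le_nhds
    have hadd : ∀ {r s : ℝ}, 0 ≤ r → 0 ≤ s → ContinuousLinearMap.adjoint (S.op (r + s)) z
        = ContinuousLinearMap.adjoint (S.op r) (ContinuousLinearMap.adjoint (S.op s) z) := by
      intro r s hr hs
      rw [add_comm, S.op_add s r hs hr, ContinuousLinearMap.adjoint_comp]; rfl
    have hM' : ∀ r ∈ Icc 0 (t + 1), ∀ y,
        ‖ContinuousLinearMap.adjoint (S.op r) y‖ ≤ M * ‖y‖ := fun r hr y =>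
      ContinuousLinearMap.le_of_opNorm_le _
        ((LinearIsometryEquiv.norm_map _ _).trans_le (hM r hr)) _
    have ht0 : 0 ≤ t := ht
    rw [ContinuousWithinAt, tendsto_iff_norm_sub_tendsto_zero]
    refine squeeze_zero_norm' ?_ hz
    filter_upwards [self_mem_nhdsWithin,
      nhdsWithin_le_nhds (Iic_mem_nhds (lt_add_one t))] with r hr0 hr1
    rw [norm_norm]
    rcases le_total r t with h | h
    · have := hadd hr0 (sub_nonneg.2 h)
      rw [add_sub_cancel] at this
      rw [this, abs_sub_comm, abs_of_nonneg (sub_nonneg.2 h), norm_sub_rev, ← map_sub]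
      exact hM' r ⟨hr0, hr1⟩ _
    · have := hadd ht0 (sub_nonneg.2 h)
      rw [add_sub_cancel] at this
      rw [this, abs_of_nonneg (sub_nonneg.2 h), ← map_sub]
      exact hM' t ⟨ht0, by linarith⟩ _

lemma adjoint_op (S : C0Semigroup H) (t : ℝ) :
    S.adjoint.op t = ContinuousLinearMap.adjoint (S.op t) := rfl

lemma inner_adjoint_op_left (S : C0Semigroup H) (t : ℝ) (x y : H) :
    ⟪S.adjoint.op t x, y⟫ = ⟪x, S.op t y⟫ :=
  ContinuousLinearMap.adjoint_inner_left _ _ _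

/-- The generator of the adjoint semigroup is the adjoint of the generator. -/
lemma hasGenerator_adjoint_iff (S : C0Semigroup H) {x y : H} :
    S.adjoint.HasGenerator x y ↔
      ∃ h : x ∈ S.generator.adjoint.domain, S.generator.adjoint ⟨x, h⟩ = y := by
  constructor
  · intro h
    have key : ∀ z : S.generator.domain, ⟪y, (z : H)⟫ = ⟪x, S.generator z⟫ := by
      intro z
      refine tendsto_nhds_unique (h.inner (tendsto_const_nhds (x := (z : H))))
        (((tendsto_const_nhds (x := x)).inner (S.hasGenerator_generator z)).congr fun t => ?_)
      rw [inner_smul_left, inner_smul_right, inner_sub_left, inner_sub_right,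
        S.inner_adjoint_op_left]
      rfl
    have hx := LinearPMap.mem_adjoint_domain_of_exists (T := S.generator) x ⟨y, key⟩
    exact ⟨hx, LinearPMap.adjoint_apply_eq S.dense_generator_domain ⟨x, hx⟩ key⟩
  · rintro ⟨hx, rfl⟩
    set y := S.generator.adjoint ⟨x, hx⟩
    have h := tendsto_average_right (S.adjoint.continuousOn y)
    rw [S.adjoint.op_zero_apply] at h
    refine h.congr' ?_
    filter_upwards [self_mem_nhdsWithin] with t ht
    have ht0 : 0 ≤ t := (mem_Ioi.1 ht).le
    congr 1
    refine ext_inner_right ℝ fun v => ?_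
    rw [adjoint_op, S.inner_adjoint_op_sub ⟨x, hx⟩ ht0 v, zero_add, real_inner_comm]
    have h1 := ContinuousLinearMap.intervalIntegral_comp_comm (innerSL ℝ v)
      (intervalIntegrable_of_continuousOn_Ici (S.adjoint.continuousOn y) le_rfl ht0)
    have h2 := ContinuousLinearMap.intervalIntegral_comp_comm (innerSL ℝ y)
      (intervalIntegrable_of_continuousOn_Ici (S.continuousOn v) le_rfl ht0)
    simp only [innerSL_apply_apply] at h1 h2
    rw [← h1, ← h2]
    refine intervalIntegral.integral_congr fun s _ => ?_
    rw [real_inner_comm, S.inner_adjoint_op_left]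

/-- A bounded operator intertwines two semigroups iff it intertwines their generators. -/
lemma intertwines_iff_hasGenerator (S T : C0Semigroup H) (Q : H →L[ℝ] H) :
    (∀ t, 0 ≤ t → (S.op t).comp Q = Q.comp (T.op t)) ↔
      ∀ x y, T.HasGenerator x y → S.HasGenerator (Q x) (Q y) := by
  constructor
  · intro h x y hxy
    refine ((Q.continuous.tendsto y).comp hxy).congr' ?_
    filter_upwards [self_mem_nhdsWithin] with t ht
    have := DFunLike.congr_fun (h t (mem_Ioi.1 ht).le) x
    simp only [ContinuousLinearMap.comp_apply] at this
    simp only [Function.comp, map_smul, map_sub, this]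
  · intro h t ht
    have hdom : ∀ x ∈ (T.generator.domain : Set H), S.op t (Q x) = Q (T.op t x) := by
      intro x hx
      have hxy := T.hasGenerator_generator ⟨x, hx⟩
      set y := T.generator ⟨x, hx⟩
      simp only at hxy
      -- `r ↦ S(t-r) Q T(r) x` has vanishing right derivative on `[0, t)`.
      have hcont : ContinuousOn (fun r => S.op (t - r) (Q (T.op r x))) (Icc 0 t) :=
        S.continuousOn_op_apply (by fun_prop) (fun r hr => sub_nonneg.2 hr.2)
          (Q.continuous.comp_continuousOn ((T.continuousOn x).mono fun r hr => hr.1))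
      have hder : ∀ r ∈ Ico 0 t, HasDerivWithinAt (fun r => S.op (t - r) (Q (T.op r x))) 0
          (Ici r) r := by
        intro r hr
        have hb : Tendsto (fun e : ℝ => Q (e⁻¹ • (T.op e (T.op r x) - T.op r x))
            - e⁻¹ • (S.op e (Q (T.op r x)) - Q (T.op r x))) (𝓝[>] 0) (𝓝 0) := by
          have h1 := hxy.op hr.1
          simpa using ((Q.continuous.tendsto _).comp h1).sub (h _ _ h1)
        have hτ : Tendsto (fun e : ℝ => t - r - e) (𝓝[>] 0) (𝓝 (t - r)) := by
          have : Continuous fun e : ℝ => t - r - e := by fun_prop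
          simpa using (this.tendsto 0).mono_left nhdsWithin_le_nhds
        have hpos : ∀ᶠ e : ℝ in 𝓝[>] 0, 0 ≤ t - r - e := by
          filter_upwards [nhdsWithin_le_nhds (Iic_mem_nhds (sub_pos.2 hr.2))] with e he
          exact sub_nonneg.2 he
        have hlim := S.tendsto_op_apply (sub_nonneg.2 hr.2.le) hpos hτ hb
        rw [map_zero] at hlim
        rw [hasDerivWithinAt_iff_tendsto_slope, Ici_sdiff_left]
        have hshift : Tendsto (fun q : ℝ => q - r) (𝓝[>] r) (𝓝[>] 0) := by
          refine tendsto_nhdsWithin_iff.2 ⟨?_, ?_⟩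
          · have : Continuous fun q : ℝ => q - r := by fun_prop
            simpa using (this.tendsto r).mono_left nhdsWithin_le_nhds
          · filter_upwards [self_mem_nhdsWithin] with q hq
            exact mem_Ioi.2 (sub_pos.2 (mem_Ioi.1 hq))
        refine (hlim.comp hshift).congr' ?_
        filter_upwards [self_mem_nhdsWithin, nhdsWithin_le_nhds (Iic_mem_nhds hr.2)] with q hq hqt
        have hq0 : 0 ≤ q - r := sub_nonneg.2 (mem_Ioi.1 hq).le
        have e1 : T.op (q - r) (T.op r x) = T.op q x := by
          rw [← T.op_add_apply hq0 hr.1, sub_add_cancel]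
        have e2 : S.op (t - q) (S.op (q - r) (Q (T.op r x))) = S.op (t - r) (Q (T.op r x)) := by
          rw [← S.op_add_apply (sub_nonneg.2 hqt) hq0]; congr 2; ring
        rw [slope_def_module]
        have e3 : t - r - (q - r) = t - q := by ring
        simp only [Function.comp, e3, e1, map_sub, map_smul, e2, ← smul_sub]
        congr 1
        abel
      have := constant_of_has_deriv_right_zero hcont hder t (right_mem_Icc.2 ht)
      simpa [S.op_zero_apply, T.op_zero_apply] using this.symm
    ext x
    exact (T.dense_generator_domain.induction (P := fun x => S.op t (Q x) = Q (T.op t x)) hdom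
      (isClosed_eq (by fun_prop) (by fun_prop))) x

end C0Semigroup
end OU

/-! ### Hilbert–Schmidt factors of the covariance operators -/

namespace OU

section HilbertSchmidt

variable {H : Type*} [NormedAddCommGroup H]

lemma enorm_sq_eq_lintegral {α : Type*} [MeasurableSpace α] {m : Measure α} {f : α → H}
    {F : Lp H 2 m} (h : F =ᵐ[m] f) : ‖F‖ₑ ^ 2 = ∫⁻ s, ‖f s‖ₑ ^ 2 ∂m := by
  rw [Lp.enorm_def, eLpNorm_congr_ae h, eLpNorm_eq_lintegral_rpow_enorm_toReal (by simp) (by simp)]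
  simp only [ENNReal.toReal_ofNat, ENNReal.rpow_ofNat]
  rw [← ENNReal.rpow_natCast, ← ENNReal.rpow_mul]
  norm_num

lemma memLp_two_of_lintegral_lt_top {α : Type*} [MeasurableSpace α] {m : Measure α} {f : α → H}
    (hf : AEStronglyMeasurable f m) (h : ∫⁻ s, ‖f s‖ₑ ^ 2 ∂m < ∞) : MemLp f 2 m := by
  refine ⟨hf, ?_⟩
  rw [eLpNorm_lt_top_iff_lintegral_rpow_enorm_lt_top (by simp) (by simp)]
  simpa using h

variable [InnerProductSpace ℝ H]

lemma countable_of_hilbertBasis [TopologicalSpace.SeparableSpace H] {ι : Type*}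
    (b : HilbertBasis ι ℝ H) : Countable ι := by
  have hd : Pairwise (Function.onFun Disjoint fun i => Metric.ball (b i) (1 / 2)) := by
    intro i j hij
    refine Metric.ball_disjoint_ball ?_
    have h1 : ‖b i - b j‖ ^ 2 = 2 := by
      rw [norm_sub_sq_real, b.orthonormal.1 i, b.orthonormal.1 j, b.orthonormal.2 hij]
      norm_num
    rw [dist_eq_norm]
    nlinarith [norm_nonneg (b i - b j)]
  have hd' : (univ : Set ι).PairwiseDisjoint fun i => Metric.ball (b i) (1 / 2) :=
    fun i _ j _ hij => hd hij
  exact Set.countable_univ_iff.1 (hd'.countable_of_isOpen (fun i _ => Metric.isOpen_ball)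
    fun i _ => Metric.nonempty_ball.2 (by norm_num))

/-- The operator norm is dominated by the Hilbert–Schmidt norm. -/
lemma enorm_sq_le_tsum_mul {E : Type*} [NormedAddCommGroup E] [NormedSpace ℝ E] {ι : Type*}
    (b : HilbertBasis ι ℝ H) (G : H →L[ℝ] E) (y : H) :
    ‖G y‖ₑ ^ 2 ≤ (∑' i, ‖G (b i)‖ₑ ^ 2) * ‖y‖ₑ ^ 2 := by
  rcases eq_or_ne y 0 with rfl | hy
  · simp
  rcases eq_or_ne (∑' i, ‖G (b i)‖ₑ ^ 2) ∞ with htop | htop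
  · rw [htop, ENNReal.top_mul (by simpa using hy)]
    exact le_top
  have hfin : ∀ s : Finset ι, ‖G (∑ i ∈ s, b.repr y i • b i)‖ₑ ^ 2
      ≤ (∑' i, ‖G (b i)‖ₑ ^ 2) * ‖y‖ₑ ^ 2 := by
    intro s
    have h1 : ‖G (∑ i ∈ s, b.repr y i • b i)‖ ^ 2
        ≤ (∑ i ∈ s, ‖G (b i)‖ ^ 2) * ‖y‖ ^ 2 := by
      have h2 : ‖G (∑ i ∈ s, b.repr y i • b i)‖ ≤ ∑ i ∈ s, ‖G (b i)‖ * ‖b.repr y i‖ := by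
        rw [map_sum]
        refine norm_sum_le_of_le _ fun i _ => ?_
        rw [map_smul, norm_smul, mul_comm]
      have h3 : ∑ i ∈ s, ‖b.repr y i‖ ^ 2 ≤ ‖y‖ ^ 2 := by
        simpa only [b.repr_apply_apply] using
          b.orthonormal.sum_inner_products_le (x := y) (s := s)
      calc _ ≤ (∑ i ∈ s, ‖G (b i)‖ * ‖b.repr y i‖) ^ 2 := by gcongr
        _ ≤ (∑ i ∈ s, ‖G (b i)‖ ^ 2) * ∑ i ∈ s, ‖b.repr y i‖ ^ 2 :=
            Finset.sum_mul_sq_le_sq_mul_sq _ _ _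
        _ ≤ _ := by gcongr
    calc _ = ENNReal.ofReal (‖G (∑ i ∈ s, b.repr y i • b i)‖ ^ 2) := by
            rw [← ofReal_norm, ENNReal.ofReal_pow (norm_nonneg _)]
      _ ≤ ENNReal.ofReal ((∑ i ∈ s, ‖G (b i)‖ ^ 2) * ‖y‖ ^ 2) := ENNReal.ofReal_le_ofReal h1
      _ = (∑ i ∈ s, ‖G (b i)‖ₑ ^ 2) * ‖y‖ₑ ^ 2 := by
            rw [ENNReal.ofReal_mul (by positivity), ENNReal.ofReal_sum_of_nonneg
              fun i _ => by positivity]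
            simp only [ENNReal.ofReal_pow (norm_nonneg _), ofReal_norm]
      _ ≤ _ := by gcongr; exact ENNReal.sum_le_tsum s
  have hlim : Tendsto (fun s : Finset ι => ‖G (∑ i ∈ s, b.repr y i • b i)‖ₑ ^ 2) atTop
      (𝓝 (‖G y‖ₑ ^ 2)) :=
    ((ENNReal.continuous_pow 2).comp (continuous_enorm.comp G.continuous)).tendsto _ |>.comp
      (b.hasSum_repr y)
  exact le_of_tendsto' hlim hfin

/-- An operator-valued function with square integrable Hilbert–Schmidt norm defines a
Hilbert–Schmidt operator `y ↦ Φ(·)y` with values in `L²`. -/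
lemma exists_hilbertSchmidt_toLp {ι α : Type*} [Countable ι] [MeasurableSpace α] {m : Measure α}
    (b : HilbertBasis ι ℝ H) (Φ : α → H →L[ℝ] H)
    (hΦ : ∀ y, AEStronglyMeasurable (fun s => Φ s y) m)
    (hfin : ∫⁻ s, ∑' i, ‖Φ s (b i)‖ₑ ^ 2 ∂m < ∞) :
    ∃ F : H →L[ℝ] Lp H 2 m, (∀ y, F y =ᵐ[m] fun s => Φ s y) ∧
      Summable fun i => ‖F (b i)‖ ^ 2 := by
  set K := ∫⁻ s, ∑' i, ‖Φ s (b i)‖ₑ ^ 2 ∂m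
  have hbound : ∀ y, ∫⁻ s, ‖Φ s y‖ₑ ^ 2 ∂m ≤ K * ‖y‖ₑ ^ 2 := by
    intro y
    rw [← lintegral_mul_const' _ _ (by simp)]
    exact lintegral_mono fun s => enorm_sq_le_tsum_mul b (Φ s) y
  have hmem : ∀ y, MemLp (fun s => Φ s y) 2 m := fun y =>
    memLp_two_of_lintegral_lt_top (hΦ y)
      ((hbound y).trans_lt (ENNReal.mul_lt_top hfin (by simp)))
  let F₀ : H →ₗ[ℝ] Lp H 2 m :=
    { toFun := fun y => (hmem y).toLp _
      map_add' := fun y z => by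
        rw [← MemLp.toLp_add]
        exact MemLp.toLp_congr _ _ (.of_forall fun s => map_add _ _ _)
      map_smul' := fun c y => by
        rw [RingHom.id_apply, ← MemLp.toLp_const_smul]
        exact MemLp.toLp_congr _ _ (.of_forall fun s => map_smul _ _ _) }
  have hF₀ : ∀ y, F₀ y =ᵐ[m] fun s => Φ s y := fun y => (hmem y).coeFn_toLp
  let F : H →L[ℝ] Lp H 2 m := F₀.mkContinuous (√K.toReal) fun y => by
    refine abs_le_of_sq_le_sq' ?_ (by positivity) |>.2
    rw [mul_pow, Real.sq_sqrt ENNReal.toReal_nonneg]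
    have h1 := (enorm_sq_eq_lintegral (hF₀ y)).trans_le (hbound y)
    have h2 := ENNReal.toReal_mono (ENNReal.mul_lt_top hfin (by simp)).ne h1
    simpa [ENNReal.toReal_mul, ENNReal.toReal_pow] using h2
  refine ⟨F, hF₀, ?_⟩
  have hsum : ∑' i, ‖F (b i)‖ₑ ^ 2 ≠ ∞ := by
    have : ∀ i, ‖F (b i)‖ₑ ^ 2 = ∫⁻ s, ‖Φ s (b i)‖ₑ ^ 2 ∂m := fun i =>
      enorm_sq_eq_lintegral (hF₀ (b i))
    simp only [this]
    rw [← lintegral_tsum fun i => (hΦ (b i)).enorm.pow_const 2]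
    exact hfin.ne
  simpa [ENNReal.toReal_pow] using ENNReal.summable_toReal hsum

end HilbertSchmidt

section Covariance

variable {H : Type*} [NormedAddCommGroup H] [InnerProductSpace ℝ H] [CompleteSpace H]

lemma inner_covIntegrand (S : C0Semigroup H) {Q : H →L[ℝ] H} (hQ : Q.IsPositive) (s : ℝ)
    (x y : H) :
    ⟪covIntegrand S Q s x, y⟫ = ⟪opSqrt Q (S.adjoint.op s x), opSqrt Q (S.adjoint.op s y)⟫ := by
  have h1 := (opSqrt_isPositive hQ).inner_left_eq_inner_right
    (opSqrt Q (S.adjoint.op s x)) (S.adjoint.op s y)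
  have h2 : opSqrt Q (opSqrt Q (S.adjoint.op s x)) = Q (S.adjoint.op s x) :=
    DFunLike.congr_fun (opSqrt_comp_opSqrt hQ) _
  rw [← h1, h2]
  exact (ContinuousLinearMap.adjoint_inner_right (S.op s) _ _).symm

lemma adjoint_op_comp_opSqrt (S : C0Semigroup H) {Q : H →L[ℝ] H} (hQ : Q.IsPositive) (s : ℝ)
    (y : H) :
    ContinuousLinearMap.adjoint ((S.op s).comp (opSqrt Q)) y = opSqrt Q (S.adjoint.op s y) := by
  rw [ContinuousLinearMap.adjoint_comp, (opSqrt_isPositive hQ).isSelfAdjoint.adjoint_eq]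
  rfl

/-- The orthonormal basis used by `posTrace`. -/
noncomputable def traceBasis (H : Type*) [NormedAddCommGroup H] [InnerProductSpace ℝ H]
    [CompleteSpace H] : HilbertBasis (exists_hilbertBasis ℝ H).choose ℝ H :=
  (exists_hilbertBasis ℝ H).choose_spec.choose

lemma posTrace_covIntegrand (S : C0Semigroup H) {Q : H →L[ℝ] H} (hQ : Q.IsPositive) (s : ℝ) :
    posTrace (covIntegrand S Q s)
      = ∑' i, ‖opSqrt Q (S.adjoint.op s (traceBasis H i))‖ₑ ^ 2 := by
  refine tsum_congr fun i => ?_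
  rw [inner_covIntegrand S hQ, real_inner_self_eq_norm_sq, ENNReal.ofReal_pow (norm_nonneg _),
    ofReal_norm]
  rfl

lemma continuousOn_opSqrt_adjoint_op (S : C0Semigroup H) (Q : H →L[ℝ] H) (y : H) :
    ContinuousOn (fun s => opSqrt Q (S.adjoint.op s y)) (Ici 0) :=
  (opSqrt Q).continuous.comp_continuousOn (S.adjoint.continuousOn y)

lemma setLIntegral_Ioc_sub_left (f : ℝ → ℝ≥0∞) (t : ℝ) :
    ∫⁻ s in Ioc 0 t, f (t - s) = ∫⁻ s in Ioc 0 t, f s := by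
  rw [← restrict_Ioo_eq_restrict_Ioc, ← lintegral_indicator measurableSet_Ioo,
    ← lintegral_indicator measurableSet_Ioo,
    ← lintegral_sub_left_eq_self ((Ioo 0 t).indicator f) t]
  congr 1
  ext s
  simp only [indicator, mem_Ioo]
  congr 1
  exact propext ⟨fun h => ⟨by linarith, by linarith⟩, fun h => ⟨by linarith, by linarith⟩⟩

/-- For `y ∈ H`, the function `s ↦ √Q S*(s) y` as an element of `L²((0, ∞); H)`; the operator so
defined is a Hilbert–Schmidt square root of `Q_∞`: one has `Q_∞ = F* F`. -/
lemma exists_covariance_factor [TopologicalSpace.SeparableSpace H] (S : C0Semigroup H)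
    {Q : H →L[ℝ] H} (hQ : Q.IsPositive) (hyp : StandingHypothesis S Q) :
    ∃ F : H →L[ℝ] Lp H 2 (volume.restrict (Ioi (0 : ℝ))),
      (∀ y, F y =ᵐ[volume.restrict (Ioi (0 : ℝ))] fun s => opSqrt Q (S.adjoint.op s y)) ∧
      Summable fun i => ‖F (traceBasis H i)‖ ^ 2 := by
  have := countable_of_hilbertBasis (traceBasis H)
  refine exists_hilbertSchmidt_toLp (m := volume.restrict (Ioi (0 : ℝ))) (traceBasis H)
    (fun s => (opSqrt Q).comp (S.adjoint.op s)) (fun y => ?_) ?_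
  · exact ((continuousOn_opSqrt_adjoint_op S Q y).mono Ioi_subset_Ici_self).aestronglyMeasurable
      measurableSet_Ioi
  · have h := hyp.1
    simp only [posTrace_covIntegrand S hQ] at h
    exact h

lemma mildIntegrand_eq (S : C0Semigroup H) {Q : H →L[ℝ] H} (hQ : Q.IsPositive) (t : ℝ) (y : H) :
    mildIntegrand S Q t y =
      (Ioc 0 t).indicator fun s => opSqrt Q (S.adjoint.op (t - s) y) := by
  simp only [mildIntegrand, adjoint_op_comp_opSqrt S hQ]

lemma setLIntegral_Ioi_indicator_Ioc (f : ℝ → ℝ≥0∞) (t : ℝ) :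
    ∫⁻ s in Ioi 0, (Ioc 0 t).indicator f s = ∫⁻ s in Ioc 0 t, f s := by
  rw [lintegral_indicator measurableSet_Ioc,
    Measure.restrict_restrict_of_subset Ioc_subset_Ioi_self]

/-- The analogue of `exists_covariance_factor` for the integrand of the mild solution at time
`t`. -/
lemma exists_mild_factor [TopologicalSpace.SeparableSpace H] (S : C0Semigroup H)
    {Q : H →L[ℝ] H} (hQ : Q.IsPositive) (hyp : StandingHypothesis S Q) (t : ℝ) :
    ∃ F : H →L[ℝ] Lp H 2 (volume.restrict (Ioi (0 : ℝ))),
      (∀ y, F y =ᵐ[volume.restrict (Ioi (0 : ℝ))] mildIntegrand S Q t y) ∧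
      Summable fun i => ‖F (traceBasis H i)‖ ^ 2 := by
  have := countable_of_hilbertBasis (traceBasis H)
  let Φ : ℝ → H →L[ℝ] H :=
    (Ioc 0 t).indicator fun s => (opSqrt Q).comp (S.adjoint.op (t - s))
  have hΦ : ∀ y, (fun s => Φ s y) = mildIntegrand S Q t y := by
    intro y
    ext s
    rw [mildIntegrand_eq S hQ]
    by_cases hs : s ∈ Ioc 0 t <;> simp [Φ, hs]
  have hmeas : ∀ y, AEStronglyMeasurable (fun s => Φ s y) (volume.restrict (Ioi (0 : ℝ))) := by
    intro y
    rw [hΦ, mildIntegrand_eq S hQ, aestronglyMeasurable_indicator_iff measurableSet_Ioc,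
      Measure.restrict_restrict_of_subset Ioc_subset_Ioi_self]
    refine ContinuousOn.aestronglyMeasurable ?_ measurableSet_Ioc
    exact (continuousOn_opSqrt_adjoint_op S Q y).comp (by fun_prop)
      fun s hs => sub_nonneg.2 hs.2
  have hfin : ∫⁻ s in Ioi 0, ∑' i, ‖Φ s (traceBasis H i)‖ₑ ^ 2 < ∞ := by
    have h1 : ∀ s, ∑' i, ‖Φ s (traceBasis H i)‖ₑ ^ 2
        = (Ioc 0 t).indicator (fun s => posTrace (covIntegrand S Q (t - s))) s := by
      intro s
      by_cases hs : s ∈ Ioc 0 t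
      · simp [Φ, hs, posTrace_covIntegrand S hQ]
      · simp [Φ, hs]
    simp only [h1]
    rw [setLIntegral_Ioi_indicator_Ioc,
      setLIntegral_Ioc_sub_left (fun s => posTrace (covIntegrand S Q s))]
    exact (lintegral_mono_set Ioc_subset_Ioi_self).trans_lt hyp.1
  obtain ⟨F, hF, hs⟩ := exists_hilbertSchmidt_toLp (traceBasis H) Φ hmeas hfin
  exact ⟨F, fun y => hΦ y ▸ hF y, hs⟩

section Factor

variable {S : C0Semigroup H} {Q : H →L[ℝ] H}
  {F : H →L[ℝ] Lp H 2 (volume.restrict (Ioi (0 : ℝ)))}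

/-- Splitting `∫₀^∞ ‖√Q S*(s) y‖² ds` at `s = t`, i.e. `Q_∞ = Q_t + S(t) Q_∞ S*(t)` as quadratic
forms. -/
lemma norm_sq_mild_add (hQ : Q.IsPositive)
    (hF : ∀ y, F y =ᵐ[volume.restrict (Ioi (0 : ℝ))] fun s => opSqrt Q (S.adjoint.op s y))
    {t : ℝ} (ht : 0 ≤ t) (y : H) {f : Lp H 2 (volume.restrict (Ioi (0 : ℝ)))}
    (hf : f =ᵐ[volume.restrict (Ioi (0 : ℝ))] mildIntegrand S Q t y) :
    ‖f‖ ^ 2 + ‖F (S.adjoint.op t y)‖ ^ 2 = ‖F y‖ ^ 2 := by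
  have h : ‖f‖ₑ ^ 2 + ‖F (S.adjoint.op t y)‖ₑ ^ 2 = ‖F y‖ₑ ^ 2 := by
    rw [enorm_sq_eq_lintegral hf, enorm_sq_eq_lintegral (hF y),
      enorm_sq_eq_lintegral (hF (S.adjoint.op t y)), mildIntegrand_eq S hQ]
    set g : ℝ → ℝ≥0∞ := fun s => ‖opSqrt Q (S.adjoint.op s y)‖ₑ ^ 2 with hg
    have h1 : ∀ s, ‖(Ioc 0 t).indicator (fun s => opSqrt Q (S.adjoint.op (t - s) y)) s‖ₑ ^ 2
        = (Ioc 0 t).indicator (fun s => g (t - s)) s := by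
      intro s
      by_cases hs : s ∈ Ioc 0 t <;> simp [hs, hg]
    have h2 : ∫⁻ s in Ioi 0, ‖opSqrt Q (S.adjoint.op s (S.adjoint.op t y))‖ₑ ^ 2
        = ∫⁻ s in Ioi t, g s := by
      have h3 : ∫⁻ s in Ioi 0, ‖opSqrt Q (S.adjoint.op s (S.adjoint.op t y))‖ₑ ^ 2
          = ∫⁻ s in Ioi 0, g (s + t) :=
        setLIntegral_congr_fun measurableSet_Ioi fun s hs => by
          simp only [hg, S.adjoint.op_add_apply (mem_Ioi.1 hs).le ht]
      rw [h3, ← lintegral_indicator measurableSet_Ioi, ← lintegral_indicator measurableSet_Ioi,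
        ← lintegral_add_right_eq_self ((Ioi t).indicator g) t]
      congr 1
      ext s
      simp [indicator, mem_Ioi]
    simp only [h1]
    rw [setLIntegral_Ioi_indicator_Ioc, setLIntegral_Ioc_sub_left, h2,
      ← lintegral_union measurableSet_Ioi (Ioc_disjoint_Ioi le_rfl), Ioc_union_Ioi_eq_Ioi ht]
  have h' := congrArg ENNReal.toReal h
  rw [ENNReal.toReal_add (by simp) (by simp)] at h'
  simpa [ENNReal.toReal_pow] using h'

lemma integrable_covIntegrand (hQ : Q.IsPositive) (hyp : StandingHypothesis S Q) (x : H) :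
    IntegrableOn (fun s => covIntegrand S Q s x) (Ioi 0) := by
  have hc : ContinuousOn (fun s => covIntegrand S Q s x) (Ici 0) :=
    S.continuousOn_op_apply continuousOn_id (fun _ h => h)
      (Q.continuous.comp_continuousOn (S.adjoint.continuousOn x))
  refine ⟨(hc.mono Ioi_subset_Ici_self).aestronglyMeasurable measurableSet_Ioi, ?_⟩
  have hle : ∀ s, ‖covIntegrand S Q s x‖ₑ ≤ posTrace (covIntegrand S Q s) * ‖x‖ₑ := by
    intro s
    -- `C = B B*` with `B = S(s)√Q`, and both `B`, `B*` have norm at most `(tr C)^{1/2}`.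
    have hB : ∀ y, ‖opSqrt Q (S.adjoint.op s y)‖ₑ ^ 2
        ≤ posTrace (covIntegrand S Q s) * ‖y‖ₑ ^ 2 := fun y => by
      rw [posTrace_covIntegrand S hQ]
      exact enorm_sq_le_tsum_mul (traceBasis H) ((opSqrt Q).comp (S.adjoint.op s)) y
    set c := posTrace (covIntegrand S Q s)
    set z := covIntegrand S Q s x
    rcases eq_or_ne z 0 with hz | hz
    · simp [hz]
    have h1 : ‖z‖ₑ ^ 2 ≤ ‖opSqrt Q (S.adjoint.op s x)‖ₑ * ‖opSqrt Q (S.adjoint.op s z)‖ₑ := by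
      have h2 : ‖z‖ ^ 2 ≤ ‖opSqrt Q (S.adjoint.op s x)‖ * ‖opSqrt Q (S.adjoint.op s z)‖ := by
        rw [← real_inner_self_eq_norm_sq, inner_covIntegrand S hQ]
        exact real_inner_le_norm _ _
      have h3 := ENNReal.ofReal_le_ofReal h2
      rwa [ENNReal.ofReal_mul (norm_nonneg _), ENNReal.ofReal_pow (norm_nonneg _), ofReal_norm,
        ofReal_norm, ofReal_norm] at h3
    have h4 : (‖z‖ₑ ^ 2) ^ 2 ≤ (c * ‖x‖ₑ) ^ 2 * ‖z‖ₑ ^ 2 := by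
      calc (‖z‖ₑ ^ 2) ^ 2 ≤ (‖opSqrt Q (S.adjoint.op s x)‖ₑ
            * ‖opSqrt Q (S.adjoint.op s z)‖ₑ) ^ 2 := by gcongr
        _ ≤ (c * ‖x‖ₑ ^ 2) * (c * ‖z‖ₑ ^ 2) := by
            rw [mul_pow]; exact mul_le_mul' (hB x) (hB z)
        _ = _ := by ring
    rw [sq (‖z‖ₑ ^ 2)] at h4
    have h5 := (ENNReal.mul_le_mul_iff_left (by simpa using hz) (by simp)).1 h4
    exact (ENNReal.pow_le_pow_left_iff two_ne_zero).1 h5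
  calc ∫⁻ s in Ioi 0, ‖covIntegrand S Q s x‖ₑ
      ≤ ∫⁻ s in Ioi 0, posTrace (covIntegrand S Q s) * ‖x‖ₑ := lintegral_mono hle
    _ = (∫⁻ s in Ioi 0, posTrace (covIntegrand S Q s)) * ‖x‖ₑ :=
        lintegral_mul_const' _ _ (by simp)
    _ < ∞ := ENNReal.mul_lt_top hyp.1 (by simp)

lemma inner_Qinf (hQ : Q.IsPositive) (hyp : StandingHypothesis S Q)
    (hF : ∀ y, F y =ᵐ[volume.restrict (Ioi (0 : ℝ))] fun s => opSqrt Q (S.adjoint.op s y))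
    (x y : H) : ⟪Qinf S Q x, y⟫ = ⟪F x, F y⟫ := by
  rw [L2.inner_def, real_inner_comm, Qinf, ← integral_inner (integrable_covIntegrand hQ hyp x)]
  refine integral_congr_ae ?_
  filter_upwards [hF x, hF y] with s hx hy
  rw [hx, hy, real_inner_comm, inner_covIntegrand S hQ]

/-- `S(t)Q = QS*(t)` for all `t` iff `S(t)Q_∞ = Q_∞S*(t)` for all `t`. -/
lemma intertwines_iff_Qinf (hQ : Q.IsPositive) (hyp : StandingHypothesis S Q) :
    (∀ t, 0 ≤ t → (S.op t).comp Q = Q.comp (S.adjoint.op t)) ↔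
      ∀ t, 0 ≤ t → ∀ x, S.op t (Qinf S Q x) = Qinf S Q (S.adjoint.op t x) := by
  have hint := integrable_covIntegrand hQ hyp
  have hop : ∀ t x, S.op t (Qinf S Q x) = ∫ s in Ioi 0, S.op t (covIntegrand S Q s x) :=
    fun t x => ((S.op t).integral_comp_comm (hint x)).symm
  constructor
  · intro h t ht x
    rw [hop, Qinf]
    refine setIntegral_congr_fun measurableSet_Ioi fun s hs => ?_
    have hs0 : 0 ≤ s := (mem_Ioi.1 hs).le
    have h1 : S.op t (Q (S.adjoint.op s x)) = Q (S.adjoint.op t (S.adjoint.op s x)) :=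
      DFunLike.congr_fun (h t ht) _
    change S.op t (S.op s (Q (S.adjoint.op s x))) = S.op s (Q (S.adjoint.op s (S.adjoint.op t x)))
    rw [S.op_comm_apply ht hs0, h1, S.adjoint.op_comm_apply ht hs0]
  · intro h r hr
    -- `∫₀ᵗ S(s)QS*(s)x ds = Q_∞x - S(2t)Q_∞x`, which commutes with the semigroup in the same sense.
    have hsplit : ∀ t, 0 ≤ t → ∀ x, ∫ s in (0 : ℝ)..t, covIntegrand S Q s x
        = Qinf S Q x - S.op t (S.op t (Qinf S Q x)) := by
      intro t ht x
      have h1 : S.op t (S.op t (Qinf S Q x)) = ∫ s in Ioi t, covIntegrand S Q s x := by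
        rw [h t ht, hop]
        have h2 : ∫ s in Ioi 0, S.op t (covIntegrand S Q s (S.adjoint.op t x))
            = ∫ s in Ioi 0, covIntegrand S Q (s + t) x := by
          refine setIntegral_congr_fun measurableSet_Ioi fun s hs => ?_
          have hs0 : 0 ≤ s := (mem_Ioi.1 hs).le
          change S.op t (S.op s (Q (S.adjoint.op s (S.adjoint.op t x))))
            = S.op (s + t) (Q (S.adjoint.op (s + t) x))
          rw [S.op_comm_apply ht hs0, S.op_add_apply hs0 ht, S.adjoint.op_add_apply hs0 ht]
        rw [h2, ← integral_indicator measurableSet_Ioi, ← integral_indicator measurableSet_Ioi,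
          ← integral_add_right_eq_self ((Ioi t).indicator fun s => covIntegrand S Q s x) t]
        congr 1
        ext s
        simp [indicator, mem_Ioi]
      rw [h1, Qinf, intervalIntegral.integral_of_le ht, eq_sub_iff_add_eq,
        ← setIntegral_union (Ioc_disjoint_Ioi le_rfl) measurableSet_Ioi
          ((hint x).mono_set Ioc_subset_Ioi_self)
          ((hint x).mono_set (Ioi_subset_Ioi ht)), Ioc_union_Ioi_eq_Ioi ht]
    have hcomm : ∀ t, 0 ≤ t → ∀ x, S.op r (∫ s in (0 : ℝ)..t, covIntegrand S Q s x)
        = ∫ s in (0 : ℝ)..t, covIntegrand S Q s (S.adjoint.op r x) := by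
      intro t ht x
      rw [hsplit t ht, hsplit t ht, map_sub, ← h r hr, S.op_comm_apply ht hr (Qinf S Q x),
        S.op_comm_apply ht hr (S.op t _)]
    have hav : ∀ x, Tendsto (fun t : ℝ => t⁻¹ • ∫ s in (0 : ℝ)..t, covIntegrand S Q s x)
        (𝓝[>] 0) (𝓝 (Q x)) := by
      intro x
      have hc : ContinuousOn (fun s => covIntegrand S Q s x) (Ici 0) :=
        S.continuousOn_op_apply continuousOn_id (fun _ h => h)
          (Q.continuous.comp_continuousOn (S.adjoint.continuousOn x))
      have := tendsto_average_right hc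
      simp only [zero_add] at this
      convert this using 2
      change _ = S.op 0 (Q (S.adjoint.op 0 x))
      rw [S.op_zero_apply, S.adjoint.op_zero_apply]
    ext x
    refine tendsto_nhds_unique (((S.op r).continuous.tendsto _).comp (hav x))
      ((hav (S.adjoint.op r x)).congr' ?_)
    filter_upwards [self_mem_nhdsWithin] with t ht
    simp only [Function.comp, map_smul, hcomm t (mem_Ioi.1 ht).le]

end Factor

end Covariance
end OU

/-! ### Stochastic integrals and Gaussian measures -/

namespace OU

section RandomVector

variable {H : Type*} [NormedAddCommGroup H] [InnerProductSpace ℝ H]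
  {Ω : Type*} [MeasurableSpace Ω] {P : Measure Ω}

/-- The isometry `ξ ↦ ξ e` from `L²(Ω)` to `L²(Ω; H)`, for a unit vector `e`. -/
noncomputable def smulVector (P : Measure Ω) (e : H) (he : ‖e‖ = 1) : Lp ℝ 2 P →ₗᵢ[ℝ] Lp H 2 P where
  toLinearMap := ((ContinuousLinearMap.toSpanSingleton ℝ e).compLpL 2 P).toLinearMap
  norm_map' ξ := by
    have h := (ContinuousLinearMap.toSpanSingleton ℝ e).coeFn_compLpL (p := 2) (μ := P) ξ
    change ‖(ContinuousLinearMap.toSpanSingleton ℝ e).compLpL 2 P ξ‖ = _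
    rw [Lp.norm_def, Lp.norm_def]
    congr 1
    refine eLpNorm_congr_norm_ae ?_
    filter_upwards [h] with ω hω
    rw [hω, ContinuousLinearMap.toSpanSingleton_apply, norm_smul, he, mul_one]

lemma coeFn_smulVector (e : H) (he : ‖e‖ = 1) (ξ : Lp ℝ 2 P) :
    smulVector P e he ξ =ᵐ[P] fun ω => ξ ω • e :=
  ((ContinuousLinearMap.toSpanSingleton ℝ e).coeFn_compLpL (p := 2) (μ := P) ξ).trans
    (.of_forall fun ω => by simp)

/-- The stochastic integral of a Hilbert–Schmidt integrand: if `F` is Hilbert–Schmidt, then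
`y ↦ W(F y)` is represented by a random vector `I = ∑ᵢ W(F eᵢ) eᵢ`, the series converging in
`L²(Ω; H)` as its terms are orthogonal. -/
lemma exists_randomVector [CompleteSpace H] {ι : Type*} (b : HilbertBasis ι ℝ H)
    (W : CylindricalWiener H P) (F : H →L[ℝ] Lp H 2 (volume.restrict (Ioi (0 : ℝ))))
    (hF : Summable fun i => ‖F (b i)‖ ^ 2) :
    ∃ I : Lp H 2 P, ∀ y, ∀ᵐ ω ∂P, ⟪I ω, y⟫ = W.wienerIntegral (F y) ω := by
  let V : ι → Lp ℝ 2 P →ₗᵢ[ℝ] Lp H 2 P := fun i => smulVector P (b i) (b.orthonormal.1 i)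
  have hV : OrthogonalFamily ℝ (fun _ : ι => Lp ℝ 2 P) V := by
    intro i j hij ξ η
    rw [L2.inner_def, ← integral_zero Ω ℝ (μ := P)]
    refine integral_congr_ae ?_
    filter_upwards [coeFn_smulVector (b i) (b.orthonormal.1 i) ξ,
      coeFn_smulVector (b j) (b.orthonormal.1 j) η] with ω h1 h2
    rw [h1, h2, inner_smul_left, inner_smul_right, b.orthonormal.2 hij]
    simp
  have hsum : Summable fun i => V i (W.wienerIntegral (F (b i))) := by
    rw [hV.summable_iff_norm_sq_summable fun i => W.wienerIntegral (F (b i))]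
    simpa only [LinearIsometry.norm_map] using hF
  refine ⟨∑' i, V i (W.wienerIntegral (F (b i))), fun y => ?_⟩
  set I := ∑' i, V i (W.wienerIntegral (F (b i)))
  let ℓ : Lp H 2 P →L[ℝ] Lp ℝ 2 P := (innerSL ℝ y).compLpL 2 P
  have hterm : ∀ i, ℓ (V i (W.wienerIntegral (F (b i))))
      = W.wienerIntegral (F (b.repr y i • b i)) := by
    intro i
    simp only [map_smul]
    refine Lp.ext ?_
    filter_upwards [(innerSL ℝ y).coeFn_compLpL (p := 2) (V i (W.wienerIntegral (F (b i)))),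
      coeFn_smulVector (b i) (b.orthonormal.1 i) (W.wienerIntegral (F (b i))),
      Lp.coeFn_smul (b.repr y i) (W.wienerIntegral (F (b i)))] with ω h1 h2 h3
    rw [h1, h3, h2, innerSL_apply_apply, inner_smul_right, Pi.smul_apply, smul_eq_mul,
      b.repr_apply_apply, real_inner_comm, mul_comm]
  have h1 : HasSum (fun i => ℓ (V i (W.wienerIntegral (F (b i))))) (ℓ I) :=
    hsum.hasSum.mapL ℓ
  have h2 : HasSum (fun i => W.wienerIntegral (F (b.repr y i • b i))) (W.wienerIntegral (F y)) :=
    ((b.hasSum_repr y).mapL F).mapL W.wienerIntegral.toContinuousLinearMap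
  simp only [hterm] at h1
  have h3 : ℓ I = W.wienerIntegral (F y) := h1.unique h2
  filter_upwards [(innerSL ℝ y).coeFn_compLpL (p := 2) I] with ω hω
  rw [← h3, hω, innerSL_apply_apply, real_inner_comm]

/-- The law of a random vector with components `c(y) + W(f_y)` has a Gaussian characteristic
function. -/
lemma charFun_map_of_inner_eq [MeasurableSpace H] [BorelSpace H]
    [TopologicalSpace.SeparableSpace H] (W : CylindricalWiener H P)
    {X : Ω → H} (hX : AEMeasurable X P) {y : H} {c : ℝ}
    {f : Lp H 2 (volume.restrict (Ioi (0 : ℝ)))}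
    (h : ∀ᵐ ω ∂P, ⟪X ω, y⟫ = c + W.wienerIntegral f ω) :
    charFun (P.map X) y = Complex.exp (c * Complex.I - ‖f‖ ^ 2 / 2) := by
  have : SecondCountableTopology H := UniformSpace.secondCountable_of_separable H
  have h1 : charFun (P.map (W.wienerIntegral f)) 1 = Complex.exp (-(‖f‖ ^ 2 / 2 : ℂ)) := by
    rw [W.gaussian, charFun_gaussianReal]
    congr 1
    push_cast
    simp
  rw [charFun_apply, integral_map hX (by fun_prop)]
  rw [charFun_apply_real, integral_map (Lp.aestronglyMeasurable _).aemeasurable (by fun_prop)] at h1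
  rw [sub_eq_add_neg, Complex.exp_add, ← h1, ← integral_const_mul]
  refine integral_congr_ae ?_
  filter_upwards [h] with ω hω
  rw [hω, ← Complex.exp_add]
  congr 1
  push_cast
  ring

lemma exists_isOUProcess [CompleteSpace H] [MeasurableSpace H] [BorelSpace H]
    [TopologicalSpace.SeparableSpace H] (S : C0Semigroup H) {Q : H →L[ℝ] H} (hQ : Q.IsPositive)
    (hyp : StandingHypothesis S Q) (W : CylindricalWiener H P) :
    ∃ Z : ℝ → H → Ω → H, IsOUProcess S Q W Z := by
  choose F hF hs using exists_mild_factor S hQ hyp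
  choose I hI using fun t => exists_randomVector (traceBasis H) W (F t) (hs t)
  refine ⟨fun t x ω => S.op t x + I t ω, fun t _ x => ⟨?_, fun y => ?_⟩⟩
  · exact (Lp.aestronglyMeasurable (I t)).aemeasurable.const_add _
  · have hm : MemLp (mildIntegrand S Q t y) 2 (volume.restrict (Ioi (0 : ℝ))) :=
      (memLp_congr_ae (hF t y)).1 (Lp.memLp _)
    have he : hm.toLp _ = F t y := Lp.ext (hm.coeFn_toLp.trans (hF t y).symm)
    refine ⟨hm, ?_⟩
    filter_upwards [hI t y] with ω hω
    rw [he, inner_add_left, hω]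

end RandomVector

section Invariant

variable {H : Type*} [NormedAddCommGroup H] [InnerProductSpace ℝ H]
  {F : H →L[ℝ] Lp H 2 (volume.restrict (Ioi (0 : ℝ)))}

/-- The bilinear form `(y, z) ↦ ⟪F y, F z⟫`, which is `⟪Q_∞ y, z⟫` for a factor `Q_∞ = F* F`. -/
noncomputable def factorForm (F : H →L[ℝ] Lp H 2 (volume.restrict (Ioi (0 : ℝ)))) :
    H →L[ℝ] H →L[ℝ] ℝ :=
  (innerSL ℝ).bilinearComp F F

lemma factorForm_apply (y z : H) : factorForm F y z = ⟪F y, F z⟫ := rfl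

variable [CompleteSpace H]
  [TopologicalSpace.SeparableSpace H] [MeasurableSpace H] [BorelSpace H]
  {S : C0Semigroup H} {Q : H →L[ℝ] H}

lemma charFun_of_isCenteredGaussian (hQ : Q.IsPositive) (hyp : StandingHypothesis S Q)
    (hF : ∀ y, F y =ᵐ[volume.restrict (Ioi (0 : ℝ))] fun s => opSqrt Q (S.adjoint.op s y))
    {μ : Measure H} (hμ : IsCenteredGaussian μ (Qinf S Q)) (y : H) :
    charFun μ y = Complex.exp (-(‖F y‖ ^ 2 / 2)) := by
  have := hμ.1
  have : SecondCountableTopology H := UniformSpace.secondCountable_of_separable H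
  have h0 : ∫ x, id x ∂μ = 0 := hμ.2.1
  rw [IsGaussian.charFun_eq', h0, hμ.2.2, inner_Qinf hQ hyp hF, real_inner_self_eq_norm_sq]
  congr 1
  simp

/-- The centered Gaussian measure with covariance `Q_∞` is the law of the stochastic integral of
`s ↦ S(s)√Q` over `(0, ∞)`. -/
lemma existsUnique_isCenteredGaussian {Ω : Type*} [MeasurableSpace Ω] {P : Measure Ω}
    [IsProbabilityMeasure P] (W : CylindricalWiener H P) (hQ : Q.IsPositive)
    (hyp : StandingHypothesis S Q) :
    ∃! μ : Measure H, IsCenteredGaussian μ (Qinf S Q) := by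
  have : SecondCountableTopology H := UniformSpace.secondCountable_of_separable H
  obtain ⟨F, hF, hs⟩ := exists_covariance_factor S hQ hyp
  refine existsUnique_of_exists_of_unique ?_ fun μ ν hμ hν => ?_
  · obtain ⟨I, hI⟩ := exists_randomVector (traceBasis H) W F hs
    have hIm : AEMeasurable I P := (Lp.aestronglyMeasurable I).aemeasurable
    have : IsProbabilityMeasure (P.map I) := Measure.isProbabilityMeasure_map hIm
    have hchar : ∀ y, charFun (P.map I) y
        = Complex.exp (⟪y, (0 : H)⟫ * Complex.I - factorForm F y y / 2) := by
      intro y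
      rw [charFun_map_of_inner_eq (c := 0) W hIm
        (by filter_upwards [hI y] with ω hω; rw [hω, zero_add]), factorForm_apply,
        real_inner_self_eq_norm_sq]
      simp
    have hpos : (factorForm F).toBilinForm.IsPosSemidef :=
      ⟨⟨fun y z => by simpa [factorForm_apply] using real_inner_comm _ _⟩,
        ⟨fun y => by simp [factorForm_apply]⟩⟩
    have hcongr := gaussian_charFun_congr 0 (factorForm F) hpos hchar
    refine ⟨P.map I, isGaussian_iff_gaussian_charFun.2 ⟨0, _, hpos, hchar⟩, hcongr.1.symm,
      fun y z => ?_⟩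
    rw [← hcongr.2, factorForm_apply, inner_Qinf hQ hyp hF]
  · have := hμ.1
    have := hν.1
    refine Measure.ext_of_charFun (funext fun y => ?_)
    rw [charFun_of_isCenteredGaussian hQ hyp hF hμ, charFun_of_isCenteredGaussian hQ hyp hF hν]

end Invariant
end OU

/-! ### The Ornstein–Uhlenbeck semigroup on `L²(μ)` -/

namespace OU

section Mehler

variable {H : Type*} [MeasurableSpace H] {μ ν : Measure H}

lemma IsL2Extension.unique [IsFiniteMeasure μ] {R : (H → ℝ) → H → ℝ}
    {T T' : Lp ℝ 2 μ →L[ℝ] Lp ℝ 2 μ} (hT : IsL2Extension μ R T) (hT' : IsL2Extension μ R T') :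
    T = T' := by
  ext1 f
  refine Lp.induction (by simp) (fun f => T f = T' f) (fun c s hs hμs => ?_)
    (fun f g hf hg _ h1 h2 => by rw [map_add, map_add, h1, h2])
    (isClosed_eq T.continuous T'.continuous) f
  have hm : MemLp (s.indicator fun _ => c) 2 μ := memLp_indicator_const 2 hs c (.inr hμs.ne)
  have hb : ∃ C : ℝ, ∀ x, |s.indicator (fun _ => c) x| ≤ C := by
    refine ⟨|c|, fun x => ?_⟩
    by_cases hx : x ∈ s <;> simp [hx]
  have hmeas : Measurable (s.indicator fun _ : H => c) := measurable_const.indicator hs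
  exact Lp.ext ((hT _ hmeas hb hm).trans (hT' _ hmeas hb hm).symm)

variable [NormedAddCommGroup H] [InnerProductSpace ℝ H] {A : H →L[ℝ] H}

/-- The joint law of `(X, A X + Y)` for independent `X ∼ μ` and `Y ∼ ν`. -/
noncomputable def jointLaw (μ ν : Measure H) (A : H →L[ℝ] H) : Measure (H × H) :=
  (μ.prod ν).map fun p => (p.1, A p.1 + p.2)

variable [IsProbabilityMeasure ν]

/-- The operator `φ ↦ (x ↦ ∫ φ(A x + z) dν(z))` on `L²(μ)`, when `A X + Y ∼ μ` for independent
`X ∼ μ` and `Y ∼ ν`.  It is `U* V`, where `U` and `V` are the isometries from `L²(μ)` to `L²(μ ⊗ ν)`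
given by composition with `(x, z) ↦ x` and `(x, z) ↦ A x + z`. -/
noncomputable def mehlerOp
    (h : MeasurePreserving (fun p : H × H => A p.1 + p.2) (μ.prod ν) μ) :
    Lp ℝ 2 μ →L[ℝ] Lp ℝ 2 μ :=
  (ContinuousLinearMap.adjoint (Lp.compMeasurePreservingₗᵢ ℝ (E := ℝ) (p := 2) Prod.fst
      (measurePreserving_fst (μ := μ) (ν := ν))).toContinuousLinearMap).comp
    (Lp.compMeasurePreservingₗᵢ ℝ (E := ℝ) (p := 2) _ h).toContinuousLinearMap

lemma inner_mehlerOp (h : MeasurePreserving (fun p : H × H => A p.1 + p.2) (μ.prod ν) μ)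
    {φ ψ : Lp ℝ 2 μ} {f g : H → ℝ} (hf : φ =ᵐ[μ] f) (hg : ψ =ᵐ[μ] g) :
    ⟪mehlerOp h φ, ψ⟫ = ∫ p, f (A p.1 + p.2) * g p.1 ∂(μ.prod ν) := by
  rw [mehlerOp, ContinuousLinearMap.comp_apply, ContinuousLinearMap.adjoint_inner_left,
    L2.inner_def]
  refine integral_congr_ae ?_
  have hfst : MeasurePreserving (Prod.fst : H × H → H) (μ.prod ν) μ := measurePreserving_fst
  filter_upwards [Lp.coeFn_compMeasurePreserving φ h, Lp.coeFn_compMeasurePreserving ψ hfst,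
    h.quasiMeasurePreserving.ae hf, hfst.quasiMeasurePreserving.ae hg] with p h1 h2 h3 h4
  change ⟪Lp.compMeasurePreserving _ h φ p, Lp.compMeasurePreserving _ hfst ψ p⟫ = _
  rw [h1, h2, Function.comp, Function.comp, h3, h4]
  simp [mul_comm]

variable [SecondCountableTopology H]

lemma inner_mehlerOp_eq_jointLaw [BorelSpace H]
    (h : MeasurePreserving (fun p : H × H => A p.1 + p.2) (μ.prod ν) μ)
    {φ ψ : Lp ℝ 2 μ} {f g : H → ℝ} (hf : φ =ᵐ[μ] f) (hg : ψ =ᵐ[μ] g)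
    (hfm : Measurable f) (hgm : Measurable g) :
    ⟪mehlerOp h φ, ψ⟫ = ∫ q, f q.2 * g q.1 ∂(jointLaw μ ν A) := by
  have hm : Measurable fun q : H × H => f q.2 * g q.1 :=
    (hfm.comp measurable_snd).mul (hgm.comp measurable_fst)
  rw [inner_mehlerOp h hf hg, jointLaw, integral_map (by fun_prop) hm.aestronglyMeasurable]

variable [IsProbabilityMeasure μ]

lemma isL2Extension_mehlerOp
    (h : MeasurePreserving (fun p : H × H => A p.1 + p.2) (μ.prod ν) μ)
    {R : (H → ℝ) → H → ℝ}
    (hR : ∀ φ, Measurable φ → ∀ x, R φ x = ∫ z, φ (A x + z) ∂ν) :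
    IsL2Extension μ R (mehlerOp h) := by
  rintro φ hφ ⟨C, hC⟩ hφ2
  have hsm : StronglyMeasurable fun p : H × H => φ (A p.1 + p.2) :=
    (hφ.comp h.measurable).stronglyMeasurable
  have hRm : StronglyMeasurable (R φ) := by
    have : R φ = fun x => ∫ z, φ (A x + z) ∂ν := funext (hR φ hφ)
    rw [this]
    exact hsm.integral_prod_right
  have hRb : ∀ x, ‖R φ x‖ ≤ C := by
    intro x
    rw [hR φ hφ]
    simpa using norm_integral_le_of_norm_le_const (μ := ν) (f := fun z => φ (A x + z))
      (.of_forall fun z => hC (A x + z))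
  have hR2 : MemLp (R φ) 2 μ :=
    MemLp.of_bound hRm.aestronglyMeasurable C (.of_forall hRb)
  suffices mehlerOp h (hφ2.toLp φ) = hR2.toLp (R φ) by
    rw [this]; exact hR2.coeFn_toLp
  refine ext_inner_right ℝ fun ψ => ?_
  rw [inner_mehlerOp h hφ2.coeFn_toLp (ae_eq_refl ψ), L2.inner_def]
  have hψ : Integrable ψ μ := (Lp.memLp ψ).integrable (by norm_num)
  have hint : Integrable (fun p : H × H => φ (A p.1 + p.2) * ψ p.1) (μ.prod ν) :=
    (hψ.comp_fst ν).bdd_mul hsm.aestronglyMeasurable (.of_forall fun p => hC _)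
  rw [integral_prod _ hint]
  refine integral_congr_ae ?_
  filter_upwards [hR2.coeFn_toLp] with x hx
  rw [hx, hR φ hφ, integral_mul_const]
  simp [mul_comm]

variable [BorelSpace H]

lemma isSymmetric_mehlerOp_iff
    (h : MeasurePreserving (fun p : H × H => A p.1 + p.2) (μ.prod ν) μ) :
    (mehlerOp h).IsSymmetric ↔ (jointLaw μ ν A).map Prod.swap = jointLaw μ ν A := by
  have : IsProbabilityMeasure (jointLaw μ ν A) :=
    Measure.isProbabilityMeasure_map (by fun_prop)
  constructor
  · intro hsym
    have hpair : ∀ {s t : Set H} (hs : MeasurableSet s) (ht : MeasurableSet t),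
        ⟪mehlerOp h (indicatorConstLp 2 ht (measure_ne_top μ t) (1 : ℝ)),
          indicatorConstLp 2 hs (measure_ne_top μ s) (1 : ℝ)⟫
          = (jointLaw μ ν A).real (s ×ˢ t) := by
      intro s t hs ht
      rw [inner_mehlerOp_eq_jointLaw h indicatorConstLp_coeFn indicatorConstLp_coeFn
        (measurable_const.indicator ht) (measurable_const.indicator hs),
        ← integral_indicator_one (hs.prod ht)]
      refine integral_congr_ae (.of_forall fun q => ?_)
      by_cases h1 : q.1 ∈ s <;> by_cases h2 : q.2 ∈ t <;> simp [indicator, h1, h2]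
    have key : ∀ {s t : Set H}, MeasurableSet s → MeasurableSet t →
        (jointLaw μ ν A).real (s ×ˢ t) = (jointLaw μ ν A).real (t ×ˢ s) := by
      intro s t hs ht
      rw [← hpair hs ht, ← hpair ht hs, real_inner_comm (indicatorConstLp 2 ht _ _)]
      exact hsym _ _
    symm
    refine Measure.ext_prod fun {s t} hs ht => ?_
    rw [Measure.map_apply measurable_swap (hs.prod ht), preimage_swap_prod]
    exact (measureReal_eq_measureReal_iff).1 (key hs ht)
  · intro hswap φ ψ
    have hφ := (Lp.stronglyMeasurable φ).measurable
    have hψ := (Lp.stronglyMeasurable ψ).measurable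
    change ⟪mehlerOp h φ, ψ⟫ = ⟪φ, mehlerOp h ψ⟫
    rw [real_inner_comm (mehlerOp h ψ),
      inner_mehlerOp_eq_jointLaw h (ae_eq_refl φ) (ae_eq_refl ψ) hφ hψ,
      inner_mehlerOp_eq_jointLaw h (ae_eq_refl ψ) (ae_eq_refl φ) hψ hφ]
    conv_lhs => rw [← hswap]
    have hm : Measurable fun q : H × H => φ q.2 * ψ q.1 :=
      (hφ.comp measurable_snd).mul (hψ.comp measurable_fst)
    rw [integral_map measurable_swap.aemeasurable hm.aestronglyMeasurable]
    simp only [Prod.fst_swap, Prod.snd_swap, mul_comm]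

/-- The joint law of two centered Gaussian vectors with the same law is symmetric iff their cross
covariance is.  Here `F` is a factor of the covariance of `μ`, and the covariance of `ν` is the one
for which `A X + Y ∼ μ`. -/
lemma jointLaw_swap_eq_iff [CompleteSpace H] {E : Type*} [NormedAddCommGroup E]
    [InnerProductSpace ℝ E] {F : H →L[ℝ] E}
    (hμ : ∀ y, charFun μ y = Complex.exp (-(‖F y‖ ^ 2 / 2)))
    (hν : ∀ y, charFun ν y = Complex.exp
      (-((‖F y‖ ^ 2 - ‖F (ContinuousLinearMap.adjoint A y)‖ ^ 2) / 2))) :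
    (jointLaw μ ν A).map Prod.swap = jointLaw μ ν A ↔
      ∀ a b, ⟪F (ContinuousLinearMap.adjoint A a), F b⟫
        = ⟪F (ContinuousLinearMap.adjoint A b), F a⟫ := by
  have : IsProbabilityMeasure (jointLaw μ ν A) :=
    Measure.isProbabilityMeasure_map (by fun_prop)
  have : IsProbabilityMeasure ((jointLaw μ ν A).map Prod.swap) :=
    Measure.isProbabilityMeasure_map (by fun_prop)
  have hchar : ∀ a b, ∫ q, Complex.exp ((⟪q.1, b⟫ + ⟪q.2, a⟫ : ℝ) * Complex.I)
        ∂(jointLaw μ ν A)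
      = Complex.exp ((-((‖F a‖ ^ 2 + ‖F b‖ ^ 2) / 2
          + ⟪F (ContinuousLinearMap.adjoint A a), F b⟫) : ℝ)) := by
    intro a b
    rw [jointLaw, integral_map (by fun_prop) (by fun_prop)]
    have h1 : ∀ p : H × H, Complex.exp ((⟪p.1, b⟫ + ⟪A p.1 + p.2, a⟫ : ℝ) * Complex.I)
        = Complex.exp (⟪p.1, b + ContinuousLinearMap.adjoint A a⟫ * Complex.I)
          * Complex.exp (⟪p.2, a⟫ * Complex.I) := by
      intro p
      rw [← Complex.exp_add, inner_add_left, inner_add_right,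
        ContinuousLinearMap.adjoint_inner_right]
      congr 1
      push_cast
      ring
    simp only [h1]
    rw [integral_prod_mul (fun x : H =>
        Complex.exp (⟪x, b + ContinuousLinearMap.adjoint A a⟫ * Complex.I))
        (fun z : H => Complex.exp (⟪z, a⟫ * Complex.I)),
      ← charFun_apply, ← charFun_apply, hμ, hν, ← Complex.exp_add, map_add,
      ← Complex.ofReal_pow, norm_add_sq_real, real_inner_comm (F b)]
    congr 1
    push_cast
    ring
  have hswap : ∀ a b, ∫ q, Complex.exp ((⟪q.1, b⟫ + ⟪q.2, a⟫ : ℝ) * Complex.I)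
        ∂((jointLaw μ ν A).map Prod.swap)
      = ∫ q, Complex.exp ((⟪q.1, a⟫ + ⟪q.2, b⟫ : ℝ) * Complex.I) ∂(jointLaw μ ν A) := by
    intro a b
    rw [integral_map (by fun_prop) (by fun_prop)]
    simp only [Prod.fst_swap, Prod.snd_swap, add_comm]
  constructor
  · intro h a b
    have h1 := hswap a b
    rw [h, hchar, hchar, ← Complex.ofReal_exp, ← Complex.ofReal_exp, Complex.ofReal_inj,
      Real.exp_eq_exp] at h1
    linarith
  · intro h
    refine Measure.ext_of_charFunDual (funext fun L => ?_)
    obtain ⟨b, hb⟩ := (InnerProductSpace.toDual ℝ H).surjective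
      (L.comp (ContinuousLinearMap.inl ℝ H H))
    obtain ⟨a, ha⟩ := (InnerProductSpace.toDual ℝ H).surjective
      (L.comp (ContinuousLinearMap.inr ℝ H H))
    have hL : ∀ q : H × H, L q = ⟪q.1, b⟫ + ⟪q.2, a⟫ := by
      intro q
      have h1 := DFunLike.congr_fun hb q.1
      have h2 := DFunLike.congr_fun ha q.2
      simp only [InnerProductSpace.toDual_apply_apply, ContinuousLinearMap.comp_apply,
        ContinuousLinearMap.inl_apply, ContinuousLinearMap.inr_apply] at h1 h2
      rw [real_inner_comm b, real_inner_comm a, h1, h2, ← map_add]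
      simp
    simp only [charFunDual_apply, hL]
    rw [hswap, hchar, hchar, h a b, add_comm (‖F a‖ ^ 2)]

end Mehler

section Transition

variable {H : Type*} [NormedAddCommGroup H] [InnerProductSpace ℝ H] [CompleteSpace H]
  [TopologicalSpace.SeparableSpace H] [MeasurableSpace H] [BorelSpace H]
  {S : C0Semigroup H} {Q : H →L[ℝ] H}
  {Ω : Type*} [MeasurableSpace Ω] {P : Measure Ω}
  {W : CylindricalWiener H P} {Z : ℝ → H → Ω → H}

lemma IsOUProcess.charFun_map (hZ : IsOUProcess S Q W Z) (hQ : Q.IsPositive)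
    {F : H →L[ℝ] Lp H 2 (volume.restrict (Ioi (0 : ℝ)))}
    (hF : ∀ y, F y =ᵐ[volume.restrict (Ioi (0 : ℝ))] fun s => opSqrt Q (S.adjoint.op s y))
    {t : ℝ} (ht : 0 ≤ t) (x y : H) :
    charFun (P.map (Z t x)) y = Complex.exp (⟪S.op t x, y⟫ * Complex.I
      - (‖F y‖ ^ 2 - ‖F (S.adjoint.op t y)‖ ^ 2) / 2) := by
  obtain ⟨hm, h⟩ := hZ t ht x
  obtain ⟨h2, hy⟩ := h y
  rw [charFun_map_of_inner_eq W hm hy]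
  have := norm_sq_mild_add hQ hF ht y h2.coeFn_toLp
  congr 2
  rw [← Complex.ofReal_pow, ← Complex.ofReal_pow, ← Complex.ofReal_pow, ← this]
  push_cast
  ring

variable [IsProbabilityMeasure P]

/-- `Z(t, x)` has the law of `S(t)x + Z(t, 0)`. -/
lemma IsOUProcess.map_eq (hZ : IsOUProcess S Q W Z) (hQ : Q.IsPositive)
    (hyp : StandingHypothesis S Q) {t : ℝ} (ht : 0 ≤ t) (x : H) :
    P.map (Z t x) = (P.map (Z t 0)).map (fun z => S.op t x + z) := by
  have : SecondCountableTopology H := UniformSpace.secondCountable_of_separable H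
  obtain ⟨F, hF, -⟩ := exists_covariance_factor S hQ hyp
  have := Measure.isProbabilityMeasure_map (hZ t ht x).1
  have := Measure.isProbabilityMeasure_map (hZ t ht 0).1
  have : IsProbabilityMeasure ((P.map (Z t 0)).map (fun z => S.op t x + z)) :=
    Measure.isProbabilityMeasure_map (by fun_prop)
  refine Measure.ext_of_charFun (funext fun y => ?_)
  rw [charFun_map_const_add, hZ.charFun_map hQ hF ht, hZ.charFun_map hQ hF ht, ← Complex.exp_add]
  congr 1
  simp
  ring

lemma IsOUProcess.transition_eq (hZ : IsOUProcess S Q W Z) (hQ : Q.IsPositive)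
    (hyp : StandingHypothesis S Q) {t : ℝ} (ht : 0 ≤ t) {φ : H → ℝ} (hφ : Measurable φ) (x : H) :
    transition P Z t φ x = ∫ z, φ (S.op t x + z) ∂(P.map (Z t 0)) := by
  rw [transition, ← integral_map (hZ t ht x).1 hφ.aestronglyMeasurable, hZ.map_eq hQ hyp ht,
    integral_map (by fun_prop) hφ.aestronglyMeasurable]

/-- Invariance of `μ`: if `X ∼ μ` is independent of `Y ∼ Z(t, 0)`, then `S(t)X + Y ∼ μ`. -/
lemma IsOUProcess.measurePreserving (hZ : IsOUProcess S Q W Z) (hQ : Q.IsPositive)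
    (hyp : StandingHypothesis S Q) {t : ℝ} (ht : 0 ≤ t) {μ : Measure H}
    (hμ : IsCenteredGaussian μ (Qinf S Q)) :
    MeasurePreserving (fun p : H × H => S.op t p.1 + p.2) (μ.prod (P.map (Z t 0))) μ := by
  have : SecondCountableTopology H := UniformSpace.secondCountable_of_separable H
  obtain ⟨F, hF, -⟩ := exists_covariance_factor S hQ hyp
  have := Measure.isProbabilityMeasure_map (hZ t ht 0).1
  have := hμ.1
  have hm : Measurable fun p : H × H => S.op t p.1 + p.2 := by fun_prop
  have := Measure.isProbabilityMeasure_map (μ := μ.prod (P.map (Z t 0))) hm.aemeasurable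
  refine ⟨hm, Measure.ext_of_charFun (funext fun y => ?_)⟩
  rw [charFun_apply, integral_map hm.aemeasurable (by fun_prop)]
  have h1 : ∀ p : H × H, Complex.exp (⟪S.op t p.1 + p.2, y⟫ * Complex.I)
      = Complex.exp (⟪p.1, S.adjoint.op t y⟫ * Complex.I)
        * Complex.exp (⟪p.2, y⟫ * Complex.I) := by
    intro p
    rw [← Complex.exp_add, inner_add_left, real_inner_comm (S.adjoint.op t y),
      S.inner_adjoint_op_left, real_inner_comm y]
    congr 1
    push_cast
    ring
  simp only [h1]
  rw [integral_prod_mul (fun x : H => Complex.exp (⟪x, S.adjoint.op t y⟫ * Complex.I))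
      (fun z : H => Complex.exp (⟪z, y⟫ * Complex.I)),
    ← charFun_apply, ← charFun_apply, charFun_of_isCenteredGaussian hQ hyp hF hμ,
    charFun_of_isCenteredGaussian hQ hyp hF hμ, hZ.charFun_map hQ hF ht, ← Complex.exp_add]
  congr 1
  simp
  ring

/-- The operator `R_t` on `L²(μ)`, and the criterion for its symmetry: `S(t)Q_∞ = Q_∞S*(t)`. -/
lemma IsOUProcess.exists_l2Extension (hZ : IsOUProcess S Q W Z) (hQ : Q.IsPositive)
    (hyp : StandingHypothesis S Q) {t : ℝ} (ht : 0 ≤ t) {μ : Measure H}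
    (hμ : IsCenteredGaussian μ (Qinf S Q)) :
    ∃ T : Lp ℝ 2 μ →L[ℝ] Lp ℝ 2 μ, IsL2Extension μ (transition P Z t) T ∧
      (T.IsSymmetric ↔ ∀ x, S.op t (Qinf S Q x) = Qinf S Q (S.adjoint.op t x)) := by
  have : SecondCountableTopology H := UniformSpace.secondCountable_of_separable H
  obtain ⟨F, hF, -⟩ := exists_covariance_factor S hQ hyp
  have := Measure.isProbabilityMeasure_map (hZ t ht 0).1
  have := hμ.1
  have h := hZ.measurePreserving hQ hyp ht hμ
  refine ⟨mehlerOp h, isL2Extension_mehlerOp h fun φ hφ x => hZ.transition_eq hQ hyp ht hφ x, ?_⟩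
  rw [isSymmetric_mehlerOp_iff, jointLaw_swap_eq_iff (F := F)
    (charFun_of_isCenteredGaussian hQ hyp hF hμ) fun y => by
      rw [hZ.charFun_map hQ hF ht]; simp [C0Semigroup.adjoint_op]]
  simp only [← C0Semigroup.adjoint_op, ← inner_Qinf hQ hyp hF]
  refine forall_congr' fun a => ?_
  have hb : ∀ b, ⟪Qinf S Q (S.adjoint.op t b), a⟫ = ⟪S.op t (Qinf S Q a), b⟫ := by
    intro b
    rw [inner_Qinf hQ hyp hF, real_inner_comm, ← inner_Qinf hQ hyp hF, real_inner_comm,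
      S.inner_adjoint_op_left, real_inner_comm]
  simp only [hb]
  exact ⟨fun h => (ext_inner_right ℝ h).symm, fun h b => by rw [h]⟩

end Transition
end OU

theorem theorem2p4 {H : Type*} [NormedAddCommGroup H] [InnerProductSpace ℝ H] [CompleteSpace H]
    [TopologicalSpace.SeparableSpace H] [MeasurableSpace H] [BorelSpace H]
    (S : OU.C0Semigroup H) (Q : H →L[ℝ] H) (hQ : Q.IsPositive)
    (hyp : OU.StandingHypothesis S Q)
    {Ω : Type*} [MeasurableSpace Ω] (P : Measure Ω) [IsProbabilityMeasure P]
    (W : OU.CylindricalWiener H P) :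
    (∃ Z : ℝ → H → Ω → H, OU.IsOUProcess S Q W Z) ∧
    (∃! μ : Measure H, OU.IsCenteredGaussian μ (OU.Qinf S Q)) ∧
    ∀ Z : ℝ → H → Ω → H, OU.IsOUProcess S Q W Z →
      ∀ μ : Measure H, OU.IsCenteredGaussian μ (OU.Qinf S Q) →
        (∀ t : ℝ, 0 ≤ t → ∃! T : Lp ℝ 2 μ →L[ℝ] Lp ℝ 2 μ,
          OU.IsL2Extension μ (OU.transition P Z t) T) ∧
        List.TFAE [
          ∀ t : ℝ, 0 ≤ t → ∀ T : Lp ℝ 2 μ →L[ℝ] Lp ℝ 2 μ,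
            OU.IsL2Extension μ (OU.transition P Z t) T → T.IsSymmetric,
          ∀ x : S.generator.adjoint.domain, ∃ h : Q (x : H) ∈ S.generator.domain,
            S.generator ⟨Q (x : H), h⟩ = Q (S.generator.adjoint x),
          ∀ t : ℝ, 0 ≤ t →
            (S.op t).comp Q = Q.comp (ContinuousLinearMap.adjoint (S.op t))] := by
  refine ⟨OU.exists_isOUProcess S hQ hyp W, OU.existsUnique_isCenteredGaussian W hQ hyp,
    fun Z hZ μ hμ => ⟨fun t ht => ?_, ?_⟩⟩
  · have := hμ.1
    obtain ⟨T, hT, -⟩ := hZ.exists_l2Extension hQ hyp ht hμ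
    exact ⟨T, hT, fun T' hT' => hT'.unique hT⟩
  · have := hμ.1
    tfae_have 1 ↔ 3 := by
      refine Iff.trans ?_ (OU.intertwines_iff_Qinf hQ hyp).symm
      refine forall₂_congr fun t ht => ?_
      obtain ⟨T, hT, hiff⟩ := hZ.exists_l2Extension hQ hyp ht hμ
      rw [← hiff]
      exact ⟨fun h => h T hT, fun h T' hT' => hT'.unique hT ▸ h⟩
    tfae_have 3 ↔ 2 := by
      refine (S.intertwines_iff_hasGenerator S.adjoint Q).trans ⟨fun h x => ?_, fun h x y hxy => ?_⟩
      · exact S.hasGenerator_iff.1 (h x _ (S.hasGenerator_adjoint_iff.2 ⟨x.2, rfl⟩))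
      · obtain ⟨hx, rfl⟩ := S.hasGenerator_adjoint_iff.1 hxy
        exact S.hasGenerator_iff.2 (h ⟨x, hx⟩)
    tfae_finish
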